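/- Let $n\ge 0$, write $\mathbb{R}^{2n}=\mathbb{R}^n\times\mathbb{R}^n$, and let $M$ be a connected (embedded) real-analytic submanifold of $\mathbb{R}^{2n}$, of any dimension, that is not contained in any affine hyperplane. Let $\mu$ be a smooth measure on $M$, i.e. $\mu=\psi\sigma$, where $\sigma$ is the measure on $M$ induced by the Lebesgue measure of $\mathbb{R}^{2n}$ (the Riemannian volume of $M$) and $\psi:\mathbb{R}^{2n}\to\mathbb{C}$ is a smooth function whose support intersects $M$ in a compact set. Then the Weyl transform $W(\mu)$, i.e. the bounded operator on $L^2(\mathbb{R}^n)$ given for $\varphi\in L^2(\mathbb{R}^n)$ and almost every $t\in\mathbb{R}^n$ by the absolutely convergent integral $$(W(\mu)\varphi)(t)=\int_{\mathbb{R}^{2n}} e^{\pi i(x\cdot y+2y\cdot t)}\,\varphi(t+x)\,d\mu(x,y),$$ is well defined and is a compact operator. -/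

import Mathlib

open MeasureTheory
open scoped ContDiff InnerProductSpace

/-- `ℝ²ⁿ = ℝⁿ × ℝⁿ` with its Euclidean structure; a point `p` is the pair `(p.fst, p.snd)`. -/
abbrev PhaseSpace (n : ℕ) : Type :=
  WithLp 2 (EuclideanSpace ℝ (Fin n) × EuclideanSpace ℝ (Fin n))

/-- The complex Hilbert space `L²(ℝⁿ)`. -/
abbrev L2Space (n : ℕ) : Type :=
  Lp ℂ 2 (volume : Measure (EuclideanSpace ℝ (Fin n)))

/-- `M` is an (embedded, boundaryless) real-analytic submanifold of dimension `d` of the normed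
space `E`: around each of its points, a real-analytic diffeomorphism `Φ` between open subsets
of `E` straightens `M` to a `d`-dimensional linear subspace `S`. -/
def IsAnalyticSubmanifold {E : Type*} [NormedAddCommGroup E] [NormedSpace ℝ E]
    (d : ℕ) (M : Set E) : Prop :=
  ∀ p ∈ M, ∃ (S : Submodule ℝ E) (Φ : OpenPartialHomeomorph E E),
    Module.finrank ℝ S = d ∧ p ∈ Φ.source ∧
    AnalyticOnNhd ℝ Φ Φ.source ∧ AnalyticOnNhd ℝ Φ.symm Φ.target ∧
    ∀ x ∈ Φ.source, (x ∈ M ↔ Φ x ∈ S)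

/-- `H` is an affine hyperplane, i.e. a level set of a nonzero linear functional. -/
def IsAffineHyperplane {E : Type*} [NormedAddCommGroup E] [NormedSpace ℝ E]
    (H : Set E) : Prop :=
  ∃ (l : E →ₗ[ℝ] ℝ) (c : ℝ), l ≠ 0 ∧ H = {x | l x = c}

/-- The measure induced by the Lebesgue measure on a `d`-dimensional submanifold `M`: the
`d`-dimensional Hausdorff measure (normalized so that it is Lebesgue measure on `ℝᵈ`)
restricted to `M`. -/
noncomputable def surfaceMeasure {n : ℕ} (d : ℕ) (M : Set (PhaseSpace n)) :
    Measure (PhaseSpace n) :=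
  (Measure.euclideanHausdorffMeasure d).restrict M

/-- `μ` is a smooth measure on the `d`-dimensional submanifold `M`: `μ = ψ σ` where `σ` is the
induced measure on `M` and `ψ` is a smooth complex-valued function on the ambient space, whose
support meets `M` in a compact set. -/
def IsSmoothMeasureOn {n : ℕ} (d : ℕ) (M : Set (PhaseSpace n))
    (μ : ComplexMeasure (PhaseSpace n)) : Prop :=
  ∃ ψ : PhaseSpace n → ℂ, ContDiff ℝ ∞ ψ ∧ IsCompact (tsupport ψ ∩ M) ∧
    μ = (surfaceMeasure d M).withDensityᵥ ψ

/-- The integrand `exp(πi (x ⬝ y + 2 y ⬝ t)) φ(t + x)` of the Weyl transform, at `p = (x, y)`. -/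
noncomputable def weylIntegrand {n : ℕ} (φ : EuclideanSpace ℝ (Fin n) → ℂ)
    (t : EuclideanSpace ℝ (Fin n)) (p : PhaseSpace n) : ℂ :=
  Complex.exp (Real.pi * Complex.I * ((⟪p.fst, p.snd⟫_ℝ + 2 * ⟪p.snd, t⟫_ℝ : ℝ) : ℂ)) *
    φ (t + p.fst)

/-- The bounded operator `W` on `L²(ℝⁿ)` is the Weyl transform of the finite (complex) Borel
measure `ν` on `ℝ²ⁿ`: for every `φ ∈ L²(ℝⁿ)` and almost every `t`, the integral
`∫ exp(πi (x ⬝ y + 2 y ⬝ t)) φ(t + x) dν(x, y)` converges absolutely and equals `(W φ)(t)`. -/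
def IsWeylTransform {n : ℕ} (ν : ComplexMeasure (PhaseSpace n))
    (W : L2Space n →L[ℂ] L2Space n) : Prop :=
  ∀ φ : L2Space n, ∀ᵐ t : EuclideanSpace ℝ (Fin n),
    VectorMeasure.Integrable ν (weylIntegrand φ t) ∧
    W φ t = VectorMeasure.integral ν (weylIntegrand φ t) (ContinuousLinearMap.mul ℝ ℂ)

/-- A measure has at most one Weyl transform. -/
theorem IsWeylTransform.unique {n : ℕ} {ν : ComplexMeasure (PhaseSpace n)}
    {W W' : L2Space n →L[ℂ] L2Space n} (h : IsWeylTransform ν W) (h' : IsWeylTransform ν W') :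
    W = W' := by
  ext1 φ
  apply Lp.ext
  filter_upwards [h φ, h' φ] with t ht ht'
  rw [ht.2, ht'.2]

/-!
The Weyl transform of `ν` is `W(ν) = ∫ π(p) dν(p)`, where `π(x, y)` is the unitary operator on
`L²(ℝⁿ)` that sends `φ` to `t ↦ exp(πi (x ⬝ y + 2 y ⬝ t)) φ(t + x)` (`weylShift`). These operators
form a projective representation of `ℝ²ⁿ`: `π(p) π(q) = c(p, q) π(p + q)` with a unimodular cocycle
`c`, and `π(p)† = π(-p)`. Composing such operators therefore convolves their symbols, up to
unimodular factors.

Compactness of `W = W(ψσ)` follows from two facts.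

* *Operators with an integrable symbol are compact.* If `ν` has a density that is a test function,
  then `W(ν)` is an integral operator, and its kernel is a partial Fourier transform of the density,
  so that it is square-integrable by Plancherel's theorem; hence `W(ν)` is a Hilbert–Schmidt
  operator. Test functions are dense in `L¹`, and `‖W(g)‖ ≤ ‖g‖₁`
  (`HasWeylSymbol.isCompactOperator`).

* *Convolution powers of `σ` are absolutely continuous.* Let `m` be the restriction of `σ` to the
  support of `ψ`. If a nonzero linear functional `l` vanished on the tangent spaces of `M` at the
  points of a set of positive measure, then, by analyticity, it would do so on an open subset of
  `M`, and, as `M` is connected, `l` would be constant on `M`, which then lies in a hyperplane. So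
  the tangent spaces at almost all points of `M` escape any given hyperplane
  (`isTransversal_surfaceMeasure`). Consequently each convolution with `m`, or with its reflection,
  raises the almost everywhere rank of the parametrizing map by at least one until this map is a
  submersion (`HasRankGE.conv`), and the pushforward of Lebesgue measure under a submersion is
  absolutely continuous (`HasRankGE.absolutelyContinuous`).

Together they show that `(W†W)ᵏ` is compact for large `k`. For a self-adjoint `A`, compactness of
`A^(2^k)` implies that of `A`, and compactness of `W†W` implies that of `W`, because
`‖W φ‖² ≤ ‖W†W φ‖ ‖φ‖`.
-/

/-! ### Compactness criteria for operators between Hilbert spaces -/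

section CompactnessCriteria

variable {H : Type*} [NormedAddCommGroup H] [InnerProductSpace ℂ H]
  {H' : Type*} [NormedAddCommGroup H'] [InnerProductSpace ℂ H']

open Submodule in
/-- If orthonormal families of vectors on which `T` is at least `ε` have bounded size, then `T` is
at most `ε` on the orthogonal complement of a finite-dimensional subspace: a family of maximal size
spans such a subspace. -/
theorem exists_finiteDimensional_norm_apply_le (T : H →L[ℂ] H') {C : ℝ}
    (hC : ∀ (N : ℕ) (e : Fin N → H), Orthonormal ℂ e → ∑ i, ‖T (e i)‖ ^ 2 ≤ C)
    {ε : ℝ} (hε : 0 < ε) :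
    ∃ F : Submodule ℂ H, FiniteDimensional ℂ F ∧ ∀ x ∈ Fᗮ, ‖T x‖ ≤ ε * ‖x‖ := by
  by_contra! hcon
  have key : ∀ N : ℕ, ∃ e : Fin N → H, Orthonormal ℂ e ∧ ∀ i, ε < ‖T (e i)‖ := by
    intro N
    induction N with
    | zero => exact ⟨Fin.elim0, ⟨fun i => i.elim0, fun i => i.elim0⟩, fun i => i.elim0⟩
    | succ N ih =>
      obtain ⟨e, he, heT⟩ := ih
      obtain ⟨x, hxF, hx⟩ := hcon (span ℂ (Set.range e))
        (FiniteDimensional.span_of_finite ℂ (Set.finite_range e))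
      have hx0 : x ≠ 0 := by
        rintro rfl
        simp at hx
      have hxn : 0 < ‖x‖ := norm_pos_iff.mpr hx0
      refine ⟨Matrix.vecCons (((‖x‖⁻¹ : ℝ) : ℂ) • x) e, ?_, ?_⟩
      · rw [orthonormal_vecCons_iff]
        refine ⟨?_, fun i => ?_, he⟩
        · rw [norm_smul, Complex.norm_real, norm_inv, norm_norm, inv_mul_cancel₀ hxn.ne']
        · rw [inner_smul_left, (mem_orthogonal' _ _).mp hxF _ (subset_span ⟨i, rfl⟩), mul_zero]
      · intro i
        refine Fin.cases ?_ (fun j => ?_) i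
        · simp only [Matrix.cons_val_zero, map_smul]
          rw [norm_smul, Complex.norm_real, norm_inv, norm_norm, inv_mul_eq_div, lt_div_iff₀ hxn]
          exact hx
        · simpa using heT j
  obtain ⟨N, hN⟩ := exists_nat_gt (C / ε ^ 2)
  obtain ⟨e, he, heT⟩ := key N
  have h1 : ∑ _i : Fin N, ε ^ 2 ≤ ∑ i, ‖T (e i)‖ ^ 2 :=
    Finset.sum_le_sum fun i _ => pow_le_pow_left₀ hε.le (heT i).le 2
  have h2 := h1.trans (hC N e he)
  rw [Finset.sum_const, Finset.card_univ, Fintype.card_fin, nsmul_eq_mul] at h2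
  rw [div_lt_iff₀ (by positivity)] at hN
  linarith

/-- A Hilbert–Schmidt operator is compact: it is a norm limit of finite-rank operators
`T ∘ P` with orthogonal projections `P`. -/
theorem isCompactOperator_of_sum_norm_sq_le [CompleteSpace H'] (T : H →L[ℂ] H') {C : ℝ}
    (hC : ∀ (N : ℕ) (e : Fin N → H), Orthonormal ℂ e → ∑ i, ‖T (e i)‖ ^ 2 ≤ C) :
    IsCompactOperator T := by
  have hcl : IsClosed {S : H →L[ℂ] H' | IsCompactOperator S} :=
    isClosed_setOfPred_isCompactOperator
  refine hcl.closure_subset_iff.mpr subset_rfl (Metric.mem_closure_iff.mpr fun ε hε => ?_)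
  obtain ⟨F, hF, hFT⟩ := exists_finiteDimensional_norm_apply_le T hC (half_pos hε)
  refine ⟨T ∘L F.starProjection, ?_, ?_⟩
  · have hid : IsCompactOperator (id : F → F) := isCompactOperator_id_iff_finiteDimensional.mpr hF
    have h1 := (hid.comp_clm F.orthogonalProjectionOnto).clm_comp (T ∘L F.subtypeL)
    exact h1
  · rw [dist_eq_norm]
    refine lt_of_le_of_lt (ContinuousLinearMap.opNorm_le_bound _ (half_pos hε).le fun x => ?_)
      (half_lt_self hε)
    have h2 : (T - T ∘L F.starProjection) x = T (x - F.starProjection x) := by simp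
    rw [h2]
    refine (hFT _ (F.sub_starProjection_mem_orthogonal x)).trans ?_
    gcongr
    rw [← F.starProjection_orthogonal_val]
    calc ‖Fᗮ.starProjection x‖ ≤ ‖Fᗮ.starProjection‖ * ‖x‖ := ContinuousLinearMap.le_opNorm _ _
      _ ≤ 1 * ‖x‖ := by gcongr; exact Fᗮ.starProjection_norm_le
      _ = ‖x‖ := one_mul _

variable [CompleteSpace H] [CompleteSpace H']

open ContinuousLinearMap in
/-- `‖S x‖² = ⟪S† S x, x⟫` transfers total boundedness of the image of the unit ball. -/
theorem isCompactOperator_of_adjoint_comp_self (S : H →L[ℂ] H')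
    (h : IsCompactOperator (adjoint S ∘L S)) : IsCompactOperator S := by
  have hK := (isCompactOperator_iff_isCompact_closure_image_ball
    ((adjoint S ∘L S : H →L[ℂ] H) : H →ₗ[ℂ] H) one_pos).mp h
  refine (isCompactOperator_iff_isCompact_closure_image_ball (S : H →ₗ[ℂ] H') one_pos).mpr ?_
  refine (TotallyBounded.closure ?_).isCompact_of_isClosed isClosed_closure
  have hT : TotallyBounded ((adjoint S ∘L S) '' Metric.ball (0 : H) 1) :=
    hK.totallyBounded.subset subset_closure
  rw [Metric.totallyBounded_iff]
  intro ε hε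
  obtain ⟨t, hts, htf, htc⟩ := Metric.finite_approx_of_totallyBounded hT (ε ^ 2 / 2) (by positivity)
  replace hts : ∀ y ∈ t, ∃ x ∈ Metric.ball (0 : H) 1, (adjoint S ∘L S) x = y := fun y hy => hts hy
  choose! g hg using hts
  refine ⟨(fun y => S (g y)) '' t, htf.image _, ?_⟩
  rintro _ ⟨x, hx, rfl⟩
  obtain ⟨y, hy, hxy⟩ := Set.mem_iUnion₂.mp (htc ⟨x, hx, rfl⟩)
  refine Set.mem_iUnion₂.mpr ⟨S (g y), ⟨y, hy, rfl⟩, ?_⟩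
  obtain ⟨hgb, hgy⟩ := hg y hy
  rw [Metric.mem_ball, dist_eq_norm] at hxy ⊢
  simp only [ContinuousLinearMap.coe_coe]
  rw [← hgy, ← map_sub] at hxy
  rw [← map_sub]
  have h1 : ‖S (x - g y)‖ ^ 2 ≤ ‖(adjoint S ∘L S) (x - g y)‖ * ‖x - g y‖ := by
    rw [apply_norm_sq_eq_inner_adjoint_left]
    exact (Complex.re_le_norm _).trans (norm_inner_le_norm _ _)
  have h2 : ‖x - g y‖ ≤ 2 := by
    rw [Metric.mem_ball, dist_zero_right] at hx hgb
    linarith [norm_sub_le x (g y)]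
  have h3 : ‖S (x - g y)‖ ^ 2 < ε ^ 2 := by
    calc _ ≤ ‖(adjoint S ∘L S) (x - g y)‖ * 2 := h1.trans (by gcongr)
      _ < ε ^ 2 / 2 * 2 := by gcongr
      _ = ε ^ 2 := by ring
  exact lt_of_pow_lt_pow_left₀ 2 hε.le h3

/-- A self-adjoint operator with a compact power `A ^ 2 ^ k` is compact. -/
theorem isCompactOperator_of_isSelfAdjoint_of_pow (A : H →L[ℂ] H) (hA : IsSelfAdjoint A) (k : ℕ)
    (h : IsCompactOperator (A ^ 2 ^ k : H →L[ℂ] H)) : IsCompactOperator A := by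
  induction k with
  | zero => simpa using h
  | succ k ih =>
    refine ih (isCompactOperator_of_adjoint_comp_self _ ?_)
    have h1 : ContinuousLinearMap.adjoint (A ^ 2 ^ k) = A ^ 2 ^ k := (hA.pow (2 ^ k)).adjoint_eq
    rw [h1, ← ContinuousLinearMap.mul_def, ← pow_add, ← mul_two, ← pow_succ]
    exact h

end CompactnessCriteria

/-! ### Zero sets of analytic functions -/

section AnalyticZeros

open Set Filter Topology

/-- An analytic function of one real variable on an interval that is nonzero at some point of it has
countably many zeros there. -/
theorem countable_zeros_of_analyticOnNhd {F : Type*} [NormedAddCommGroup F] [NormedSpace ℝ F]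
    {g : ℝ → F} {s : Set ℝ} (hs : IsPreconnected s) (hg : AnalyticOnNhd ℝ g s) {x₀ : ℝ}
    (hx₀ : x₀ ∈ s) (h0 : g x₀ ≠ 0) : {x ∈ s | g x = 0}.Countable := by
  have hd : ∀ x ∈ s, ∀ᶠ z in 𝓝[≠] x, g z ≠ 0 := fun x hx =>
    (hg x hx).eventually_eq_zero_or_eventually_ne_zero.resolve_left fun h => h0
      (hg.eqOn_zero_of_preconnected_of_eventuallyEq_zero hs hx h hx₀)
  obtain ⟨t, hts, htc, hst⟩ := TopologicalSpace.countable_cover_nhdsWithin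
    (s := {x ∈ s | g x = 0}) (f := fun x => {z | z = x ∨ g z ≠ 0}) (by
      intro x hx
      refine mem_nhdsWithin_of_mem_nhds ?_
      have := hd x hx.1
      rw [eventually_nhdsWithin_iff] at this
      filter_upwards [this] with z hz
      by_cases h : z = x
      · exact Or.inl h
      · exact Or.inr (hz h))
  refine htc.mono fun x hx => ?_
  obtain ⟨y, hy, hxy⟩ := mem_iUnion₂.mp (hst hx)
  rcases hxy with rfl | h
  · exact hy
  · exact absurd hx.2 h

variable {V : Type*} [NormedAddCommGroup V] [NormedSpace ℝ V] [FiniteDimensional ℝ V]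
  [MeasurableSpace V] [BorelSpace V]

/-- Polar coordinates: a measurable set that meets each open ray from the origin in a countable set
and does not contain the origin is null. -/
theorem measure_eq_zero_of_countable_on_rays (μ : Measure V) [μ.IsAddHaarMeasure] {Z : Set V}
    (hZ : MeasurableSet Z) (h0 : (0 : V) ∉ Z)
    (hray : ∀ v : V, {r : ℝ | r • v ∈ Z}.Countable) : μ Z = 0 := by
  have hmp := μ.measurePreserving_homeomorphUnitSphereProd
  have hZ' : MeasurableSet ((↑) ⁻¹' Z : Set ({0}ᶜ : Set V)) := measurable_subtype_coe hZ
  have h1 : μ Z = μ.comap ((↑) : ({0}ᶜ : Set V) → V) ((↑) ⁻¹' Z) := by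
    rw [(MeasurableEmbedding.subtype_coe (measurableSet_singleton (0 : V)).compl).comap_apply,
      Subtype.image_preimage_coe, inter_eq_right.mpr]
    rintro x hx rfl
    exact h0 hx
  have hsymm := hmp.symm (homeomorphUnitSphereProd V).toMeasurableEquiv
  rw [h1, ← hsymm.measure_preimage hZ'.nullMeasurableSet,
    Measure.measure_prod_null (hsymm.measurable hZ')]
  refine Eventually.of_forall fun θ => ?_
  have hc : (Prod.mk θ ⁻¹' ((homeomorphUnitSphereProd V).toMeasurableEquiv.symm ⁻¹'
      ((↑) ⁻¹' Z)) : Set (Ioi (0 : ℝ))).Countable := by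
    refine ((hray θ).preimage Subtype.val_injective).mono fun r hr => ?_
    simpa using hr
  have hac : Measure.volumeIoiPow (Module.finrank ℝ V - 1) ≪
      Measure.comap Subtype.val (volume : Measure ℝ) := withDensity_absolutelyContinuous _ _
  refine hac ?_
  rw [(MeasurableEmbedding.subtype_coe measurableSet_Ioi).comap_apply]
  exact (hc.image _).measure_zero _

/-- The zero set of a nonzero analytic function on an open convex set is null: by polar coordinates
around a point where the function does not vanish, as its zeros on each ray are isolated. -/
theorem measure_zeros_of_analyticOnNhd {F : Type*} [NormedAddCommGroup F] [NormedSpace ℝ F]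
    (μ : Measure V) [μ.IsAddHaarMeasure] {U : Set V} (hUo : IsOpen U) (hUc : Convex ℝ U)
    {f : V → F} (hf : AnalyticOnNhd ℝ f U) {x₀ : V} (hx₀ : x₀ ∈ U) (h0 : f x₀ ≠ 0) :
    μ {x ∈ U | f x = 0} = 0 := by
  have hm : MeasurableSet {x ∈ U | f x = 0} := by
    obtain ⟨W, hW, hWU⟩ := (continuousOn_iff_isClosed.mp hf.continuousOn) {0} isClosed_singleton
    have : {x ∈ U | f x = 0} = W ∩ U := by
      rw [← hWU]; ext x; simp [and_comm]
    rw [this]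
    exact hW.measurableSet.inter hUo.measurableSet
  rw [← measure_preimage_add μ x₀]
  refine measure_eq_zero_of_countable_on_rays μ (hm.preimage (measurable_const_add x₀)) ?_ ?_
  · simp [h0]
  · intro v
    let s : Set ℝ := {r | x₀ + r • v ∈ U}
    have hs : Convex ℝ s := by
      have : s = (AffineMap.lineMap x₀ (x₀ + v) : ℝ →ᵃ[ℝ] V) ⁻¹' U := by
        ext r; simp [s, AffineMap.lineMap_apply, add_comm]
      rw [this]
      exact hUc.affine_preimage _
    have hg : AnalyticOnNhd ℝ (fun r : ℝ => f (x₀ + r • v)) s := fun r hr =>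
      (hf _ hr).comp_of_eq (f := fun r : ℝ => x₀ + r • v)
        (analyticAt_const.add (analyticAt_id.smul analyticAt_const)) rfl
    exact countable_zeros_of_analyticOnNhd hs.isPreconnected hg (x₀ := 0)
      (show x₀ + (0 : ℝ) • v ∈ U by simpa using hx₀) (by simpa using h0)

end AnalyticZeros

/-! ### Submersions and pushforwards -/

section Submersions

open Set Filter Topology

/-- The rank of a continuous linear map is lower semicontinuous. -/
theorem isOpen_setOf_le_finrank_range {V : Type*} [NormedAddCommGroup V]
    [NormedSpace ℝ V] {E : Type*} [NormedAddCommGroup E] [NormedSpace ℝ E] [FiniteDimensional ℝ E]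
    (k : ℕ) :
    IsOpen {A : V →L[ℝ] E | k ≤ Module.finrank ℝ (LinearMap.range (A : V →ₗ[ℝ] E))} := by
  have h : {A : V →L[ℝ] E | k ≤ Module.finrank ℝ (LinearMap.range (A : V →ₗ[ℝ] E))} =
      ⋃ v : Fin k → V, (fun (A : V →L[ℝ] E) i => A (v i)) ⁻¹'
        {w : Fin k → E | LinearIndependent ℝ w} := by
    ext A
    simp only [mem_ofPred_eq, mem_iUnion, mem_preimage]
    constructor
    · intro hk
      let b := Module.finBasis ℝ (LinearMap.range (A : V →ₗ[ℝ] E))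
      choose v hv using fun i => (b i).2
      refine ⟨fun i => v (Fin.castLE hk i), ?_⟩
      have hli : LinearIndependent ℝ fun i => ((b i : LinearMap.range (A : V →ₗ[ℝ] E)) : E) :=
        b.linearIndependent.map' (Submodule.subtype _) (Submodule.ker_subtype _)
      have h2 := hli.comp (Fin.castLE hk) (Fin.castLE_injective hk)
      convert h2 using 2 with i
      exact hv _
    · rintro ⟨v, hv⟩
      let w : Fin k → LinearMap.range (A : V →ₗ[ℝ] E) := fun i => ⟨A (v i), v i, rfl⟩
      have hw : LinearIndependent ℝ w :=
        LinearIndependent.of_comp (Submodule.subtype _) hv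
      simpa using hw.fintype_card_le_finrank
  rw [h]
  refine isOpen_iUnion fun v => ?_
  exact isOpen_setOfPred_linearIndependent.preimage
    (continuous_pi fun i => (ContinuousLinearMap.apply ℝ E (v i)).continuous)

variable {V : Type*} [NormedAddCommGroup V] [NormedSpace ℝ V] [FiniteDimensional ℝ V]
  [MeasurableSpace V] [BorelSpace V]
  {E : Type*} [NormedAddCommGroup E] [NormedSpace ℝ E] [MeasurableSpace E] [BorelSpace E]

theorem addHaar_preimage_eq_zero_of_surjective (ν : Measure V) [ν.IsAddHaarMeasure]
    (μ : Measure E) [μ.IsAddHaarMeasure] (A : V →L[ℝ] E) (hA : Function.Surjective A)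
    {N : Set E} (hN : MeasurableSet N) (h0 : μ N = 0) : ν (A ⁻¹' N) = 0 := by
  have h := (ae_comp_linearMap_mem_iff (A : V →ₗ[ℝ] E) ν μ hA hN.compl).mpr
    (by simpa [ae_iff] using h0)
  simpa [ae_iff, Set.preimage] using h

variable [FiniteDimensional ℝ E]

/-- Near a point where `f` is a submersion, preimages of null sets are null. With a right inverse
`R` of `A = f'(u₀)`, the map `g v = R (f v) + v - R (A v)` is a local diffeomorphism with
`f = A ∘ g`. -/
theorem exists_nhds_preimage_null_of_surjective_fderiv (ν : Measure V) [ν.IsAddHaarMeasure]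
    (μ : Measure E) [μ.IsAddHaarMeasure] {f : V → E} (hfm : Measurable f) {u₀ : V}
    (hf : ContDiffAt ℝ 1 f u₀) (hs : Function.Surjective (fderiv ℝ f u₀)) {N : Set E}
    (hN : MeasurableSet N) (h0 : μ N = 0) : ∃ W ∈ 𝓝 u₀, ν (W ∩ f ⁻¹' N) = 0 := by
  set A := fderiv ℝ f u₀ with hA
  obtain ⟨R₀, hR₀⟩ := (A : V →ₗ[ℝ] E).exists_rightInverse_of_surjective
    (LinearMap.range_eq_top.mpr hs)
  let R : E →L[ℝ] V := LinearMap.toContinuousLinearMap R₀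
  have hR : ∀ y, A (R y) = y := fun y => LinearMap.congr_fun hR₀ y
  let g : V → V := fun v => R (f v) + (v - R (A v))
  have hAg : ∀ v, A (g v) = f v := fun v => by simp [g, hR]
  have hg : ContDiffAt ℝ 1 g u₀ := by
    have h1 : ContDiffAt ℝ 1 (fun v => R (f v)) u₀ := R.contDiff.contDiffAt.comp u₀ hf
    have h2 : ContDiffAt ℝ 1 (fun v => v - R (A v)) u₀ :=
      contDiffAt_id.sub (R.contDiff.comp A.contDiff).contDiffAt
    exact h1.add h2
  have hg' : HasFDerivAt g (ContinuousLinearMap.id ℝ V) u₀ := by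
    have h1 : HasFDerivAt f A u₀ := (hf.differentiableAt one_ne_zero).hasFDerivAt
    have h2 := (R.hasFDerivAt.comp u₀ h1).add
      ((hasFDerivAt_id u₀).sub (R.hasFDerivAt.comp u₀ A.hasFDerivAt))
    convert! h2 using 1
    ext v; simp
  have hstrict : HasStrictFDerivAt g
      ((ContinuousLinearEquiv.refl ℝ V : V ≃L[ℝ] V) : V →L[ℝ] V) u₀ := by
    have := hg.hasStrictFDerivAt one_ne_zero
    rwa [hg'.fderiv] at this
  let Φ := hstrict.toOpenPartialHomeomorph g
  have hinj : InjOn g Φ.source := Φ.injOn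
  have hdet : ∀ᶠ v in 𝓝 u₀, (fderiv ℝ g v).det ≠ 0 := by
    have hc : ContinuousAt (fun v => (fderiv ℝ g v).det) u₀ :=
      ContinuousLinearMap.continuous_det.continuousAt.comp
        (hg.continuousAt_fderiv one_ne_zero)
    refine hc.eventually_ne ?_
    rw [hg'.fderiv]
    simp [ContinuousLinearMap.det]
  have hdiff : ∀ᶠ v in 𝓝 u₀, DifferentiableAt ℝ g v := by
    filter_upwards [hg.eventually (by simp)] with v hv using hv.differentiableAt one_ne_zero
  have hΦ : ∀ᶠ v in 𝓝 u₀, v ∈ Φ.source :=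
    Φ.open_source.mem_nhds hstrict.mem_toOpenPartialHomeomorph_source
  obtain ⟨W, hW, hWo, hu₀⟩ := _root_.mem_nhds_iff.mp (hdet.and (hdiff.and hΦ))
  refine ⟨W, hWo.mem_nhds hu₀, ?_⟩
  have hms : MeasurableSet (W ∩ f ⁻¹' N) := hWo.measurableSet.inter (hfm hN)
  have hint := lintegral_abs_det_fderiv_eq_addHaar_image ν (f' := fderiv ℝ g) hms
    (fun v hv => (hW hv.1).2.1.hasFDerivAt.hasFDerivWithinAt)
    (hinj.mono fun v hv => (hW hv.1).2.2)
  have himg : ν (g '' (W ∩ f ⁻¹' N)) = 0 := by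
    refine measure_mono_null ?_ (addHaar_preimage_eq_zero_of_surjective ν μ A hs hN h0)
    rintro _ ⟨v, hv, rfl⟩
    simpa [hAg] using hv.2
  rw [himg, lintegral_eq_zero_iff' (by
    refine AEMeasurable.ennreal_ofReal ?_
    exact (ContinuousLinearMap.continuous_det.measurable.comp
      (measurable_fderiv ℝ g)).abs.aemeasurable)] at hint
  rw [EventuallyEq, ae_restrict_iff' hms] at hint
  rw [measure_eq_zero_iff_ae_notMem]
  filter_upwards [hint] with v hv hvm
  have := hv hvm
  simp only [Pi.zero_apply, ENNReal.ofReal_eq_zero, abs_nonpos_iff] at this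
  exact (hW hvm.1).1 this

/-- The pushforward of Haar measure under a map that is almost everywhere a submersion is
absolutely continuous. -/
theorem map_restrict_absolutelyContinuous_of_surjective_fderiv (ν : Measure V)
    [ν.IsAddHaarMeasure] (μ : Measure E) [μ.IsAddHaarMeasure] {U : Set V} (hU : IsOpen U)
    {f : V → E} (hfm : Measurable f) (hf : ContDiffOn ℝ 1 f U)
    (hs : ∀ᵐ v ∂ν.restrict U, Function.Surjective (fderiv ℝ f v)) :
    (ν.restrict U).map f ≪ μ := by
  refine Measure.AbsolutelyContinuous.mk fun N hN h0 => ?_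
  rw [Measure.map_apply hfm hN, Measure.restrict_apply (hfm hN)]
  rw [ae_restrict_iff' hU.measurableSet] at hs
  have h1 : ν ({v ∈ U | Function.Surjective (fderiv ℝ f v)} ∩ f ⁻¹' N) = 0 := by
    refine measure_null_of_locally_null _ fun v hv => ?_
    obtain ⟨W, hW, hWN⟩ := exists_nhds_preimage_null_of_surjective_fderiv ν μ hfm
      (hf.contDiffAt (hU.mem_nhds hv.1.1)) hv.1.2 hN h0
    refine ⟨W ∩ f ⁻¹' N, ?_, hWN⟩
    exact inter_mem (mem_nhdsWithin_of_mem_nhds hW)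
      (mem_of_superset self_mem_nhdsWithin inter_subset_right)
  refine measure_mono_null ?_ (measure_union_null h1 hs)
  intro v hv
  by_cases h : Function.Surjective (fderiv ℝ f v)
  · exact Or.inl ⟨⟨hv.2, h⟩, hv.1⟩
  · exact Or.inr fun h' => h (h' hv.2)

end Submersions

/-! ### Convolutions of measures on submanifolds -/

section Convolution

open Set Filter Topology Module

theorem Submodule.exists_dual_ne_zero_le_ker {E : Type*} [NormedAddCommGroup E]
    [NormedSpace ℝ E] [FiniteDimensional ℝ E] {R : Submodule ℝ E} (hR : R ≠ ⊤) :
    ∃ l : E →L[ℝ] ℝ, l ≠ 0 ∧ ∀ x ∈ R, l x = 0 := by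
  obtain ⟨l, hl, hlR⟩ := R.exists_le_ker_of_lt_top hR.lt_top
  refine ⟨LinearMap.toContinuousLinearMap l, by simpa using hl, fun x hx => hlR hx⟩

/-- Adding an independent variable whose tangent space is not contained in some hyperplane
containing the range raises the rank. -/
theorem min_succ_le_finrank_range_coprod {V V' E : Type*} [NormedAddCommGroup V] [NormedSpace ℝ V]
    [NormedAddCommGroup V'] [NormedSpace ℝ V'] [NormedAddCommGroup E] [NormedSpace ℝ E]
    [FiniteDimensional ℝ E] {k : ℕ} {A : V →L[ℝ] E} {B : V' →L[ℝ] E}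
    (hA : min k (finrank ℝ E) ≤ finrank ℝ (LinearMap.range (A : V →ₗ[ℝ] E)))
    (hl : LinearMap.range (A : V →ₗ[ℝ] E) = ⊤ ∨
      ∃ l : E →L[ℝ] ℝ, (∀ x ∈ LinearMap.range (A : V →ₗ[ℝ] E), l x = 0) ∧ l ∘L B ≠ 0) :
    min (k + 1) (finrank ℝ E) ≤
      finrank ℝ (LinearMap.range (A.coprod B : V × V' →ₗ[ℝ] E)) := by
  have hle : LinearMap.range (A : V →ₗ[ℝ] E) ≤
      LinearMap.range (A.coprod B : V × V' →ₗ[ℝ] E) := by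
    rintro _ ⟨v, rfl⟩
    exact ⟨(v, 0), by simp⟩
  rcases hl with h | ⟨l, hlA, hlB⟩
  · rw [h, top_le_iff] at hle
    rw [hle, finrank_top]
    exact min_le_right _ _
  · have hlt : LinearMap.range (A : V →ₗ[ℝ] E) <
        LinearMap.range (A.coprod B : V × V' →ₗ[ℝ] E) := by
      refine lt_of_le_of_ne hle fun heq => hlB ?_
      ext w
      have hw : B w ∈ LinearMap.range (A.coprod B : V × V' →ₗ[ℝ] E) := ⟨(0, w), by simp⟩
      rw [← heq] at hw
      exact hlA _ hw
    have := Submodule.finrank_lt_finrank_of_lt hlt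
    omega

variable {E : Type} [NormedAddCommGroup E] [NormedSpace ℝ E] [MeasurableSpace E]

/-- `ρ` is absolutely continuous with respect to a countable sum of pushforwards of Lebesgue measure
under `C¹` maps, with the same source space, that have rank at least `min k (dim E)` almost
everywhere. The maps `γ i` are total functions; only their restrictions to the open sets `U i`
matter. -/
def HasRankGE (k : ℕ) (ρ : Measure E) : Prop :=
  ∃ (V : Type) (_ : NormedAddCommGroup V) (_ : NormedSpace ℝ V) (_ : FiniteDimensional ℝ V)
    (_ : MeasurableSpace V) (_ : BorelSpace V) (ν : Measure V) (_ : ν.IsAddHaarMeasure)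
    (ι : Type) (_ : Countable ι) (U : ι → Set V) (γ : ι → V → E),
    (∀ i, IsOpen (U i) ∧ Measurable (γ i) ∧ ContDiffOn ℝ 1 (γ i) (U i) ∧
      ∀ᵐ v ∂ν.restrict (U i), min k (finrank ℝ E) ≤
        finrank ℝ (LinearMap.range (fderiv ℝ (γ i) v : V →ₗ[ℝ] E))) ∧
    ρ ≪ Measure.sum fun i => (ν.restrict (U i)).map (γ i)

/-- `m` is absolutely continuous with respect to a countable sum of pushforwards of Lebesgue measure
under `C¹` maps whose tangent spaces are almost everywhere not contained in any fixed hyperplane. -/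
def IsTransversal (m : Measure E) : Prop :=
  ∃ (V : Type) (_ : NormedAddCommGroup V) (_ : NormedSpace ℝ V) (_ : FiniteDimensional ℝ V)
    (_ : MeasurableSpace V) (_ : BorelSpace V) (ν : Measure V) (_ : ν.IsAddHaarMeasure)
    (ι : Type) (_ : Countable ι) (U : ι → Set V) (γ : ι → V → E),
    (∀ i, IsOpen (U i) ∧ Measurable (γ i) ∧ ContDiffOn ℝ 1 (γ i) (U i) ∧
      ∀ l : E →L[ℝ] ℝ, l ≠ 0 → ∀ᵐ v ∂ν.restrict (U i), l ∘L fderiv ℝ (γ i) v ≠ 0) ∧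
    m ≪ Measure.sum fun i => (ν.restrict (U i)).map (γ i)

theorem HasRankGE.dirac_zero : HasRankGE 0 (Measure.dirac (0 : E)) := by
  refine ⟨EuclideanSpace ℝ (Fin 0), inferInstance, inferInstance, inferInstance, inferInstance,
    inferInstance, volume, inferInstance, Unit, inferInstance, fun _ => univ, fun _ _ => 0,
    fun _ => ⟨isOpen_univ, measurable_const, contDiffOn_const, by simp⟩, ?_⟩
  refine Measure.AbsolutelyContinuous.mk fun s hs h => ?_
  rw [Measure.sum_apply _ hs] at h
  simp only [Measure.restrict_univ, Measure.map_const, volume_euclideanSpace_eq_dirac] at h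
  simpa using h

theorem HasRankGE.absolutelyContinuous [FiniteDimensional ℝ E] [BorelSpace E] {k : ℕ}
    {ρ : Measure E} (h : HasRankGE k ρ)
    (hk : finrank ℝ E ≤ k) (μ : Measure E) [μ.IsAddHaarMeasure] : ρ ≪ μ := by
  obtain ⟨V, _, _, _, _, _, ν, _, ι, _, U, γ, hγ, hρ⟩ := h
  refine hρ.trans ?_
  refine Measure.AbsolutelyContinuous.mk fun s hs h0 => ?_
  rw [Measure.sum_apply _ hs, ENNReal.tsum_eq_zero]
  intro i
  obtain ⟨hU, hm, hc, hr⟩ := hγ i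
  refine map_restrict_absolutelyContinuous_of_surjective_fderiv ν μ hU hm hc ?_ h0
  filter_upwards [hr] with v hv
  rw [min_eq_right hk] at hv
  exact LinearMap.range_eq_top.mp (Submodule.eq_top_of_finrank_eq
    (le_antisymm (Submodule.finrank_le _) hv))

theorem IsTransversal.map_neg [BorelSpace E] {m : Measure E} (h : IsTransversal m) :
    IsTransversal (m.map fun x => -x) := by
  obtain ⟨V, _, _, _, _, _, ν, _, ι, _, U, γ, hγ, hm⟩ := h
  refine ⟨V, _, _, ‹_›, _, ‹_›, ν, ‹_›, ι, ‹_›, U, fun i v => -γ i v, fun i => ?_, ?_⟩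
  · obtain ⟨h1, h2, h3, h4⟩ := hγ i
    refine ⟨h1, h2.neg, h3.neg, fun l hl => ?_⟩
    filter_upwards [h4 l hl] with v hv
    rw [fderiv_fun_neg, ContinuousLinearMap.comp_neg]
    exact neg_ne_zero.mpr hv
  · have h1 := hm.map (f := fun x => -x) measurable_neg
    rw [Measure.map_sum measurable_neg.aemeasurable] at h1
    convert h1 using 3 with i
    rw [Measure.map_map measurable_neg (hγ i).2.1]
    rfl

theorem IsTransversal.mono {m m' : Measure E} (h : IsTransversal m) (hm : m' ≪ m) :
    IsTransversal m' := by
  obtain ⟨V, i1, i2, i3, i4, i5, ν, i6, ι, i7, U, γ, hγ, h'⟩ := h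
  exact ⟨V, i1, i2, i3, i4, i5, ν, i6, ι, i7, U, γ, hγ, hm.trans h'⟩

/-- Convolution with a transversal measure raises the rank by one, until it is full: at almost every
point `v` of the first factor, some hyperplane contains the range of the derivative at `v`, and the
tangent space at almost every point of the second factor is not contained in this hyperplane. -/
theorem HasRankGE.conv [FiniteDimensional ℝ E] [BorelSpace E] {k : ℕ} {ρ m : Measure E}
    [SFinite ρ] [SFinite m] (hρ : HasRankGE k ρ) (hm : IsTransversal m) :
    HasRankGE (k + 1) (ρ.conv m) := by
  obtain ⟨V, _, _, _, _, _, ν, _, ι, _, U, γ, hγ, hρ⟩ := hρ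
  obtain ⟨V', _, _, _, _, _, ν', _, ι', _, U', γ', hγ', hm⟩ := hm
  have hcm : ∀ i : ι × ι', Measurable fun p : V × V' => γ i.1 p.1 + γ' i.2 p.2 := fun i =>
    ((hγ i.1).2.1.comp measurable_fst).add ((hγ' i.2).2.1.comp measurable_snd)
  refine ⟨V × V', inferInstance, inferInstance, inferInstance, inferInstance, inferInstance,
    ν.prod ν', inferInstance, ι × ι', inferInstance, fun i => U i.1 ×ˢ U' i.2,
    fun i p => γ i.1 p.1 + γ' i.2 p.2, fun i => ⟨?_, hcm i, ?_, ?_⟩, ?_⟩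
  · exact (hγ i.1).1.prod (hγ' i.2).1
  · exact ((hγ i.1).2.2.1.comp contDiffOn_fst fun p hp => hp.1).add
      ((hγ' i.2).2.2.1.comp contDiffOn_snd fun p hp => hp.2)
  · obtain ⟨hU, -, hc, hr⟩ := hγ i.1
    obtain ⟨hU', -, hc', hr'⟩ := hγ' i.2
    set F : V × V' → E := fun p => γ i.1 p.1 + γ' i.2 p.2 with hF
    have hder : ∀ p ∈ U i.1 ×ˢ U' i.2, fderiv ℝ F p =
        (fderiv ℝ (γ i.1) p.1).coprod (fderiv ℝ (γ' i.2) p.2) := by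
      intro p hp
      have h1 : HasFDerivAt (γ i.1) (fderiv ℝ (γ i.1) p.1) p.1 :=
        ((hc.contDiffAt (hU.mem_nhds hp.1)).differentiableAt one_ne_zero).hasFDerivAt
      have h2 : HasFDerivAt (γ' i.2) (fderiv ℝ (γ' i.2) p.2) p.2 :=
        ((hc'.contDiffAt (hU'.mem_nhds hp.2)).differentiableAt one_ne_zero).hasFDerivAt
      have h3 := (h1.comp p hasFDerivAt_fst).add (h2.comp p hasFDerivAt_snd)
      rw [HasFDerivAt.fderiv (f := F) h3]
      ext v <;> simp
    have hms : MeasurableSet {p : V × V' | min (k + 1) (finrank ℝ E) ≤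
        finrank ℝ (LinearMap.range (fderiv ℝ F p : V × V' →ₗ[ℝ] E))} :=
      (isOpen_setOf_le_finrank_range _).measurableSet.preimage (measurable_fderiv ℝ F)
    rw [← Measure.prod_restrict, Measure.ae_prod_iff_ae_ae hms]
    filter_upwards [hr, ae_restrict_mem hU.measurableSet] with v hv hvU
    by_cases htop : LinearMap.range (fderiv ℝ (γ i.1) v : V →ₗ[ℝ] E) = ⊤
    · filter_upwards [ae_restrict_mem hU'.measurableSet] with w hw
      rw [hder (v, w) ⟨hvU, hw⟩]
      exact min_succ_le_finrank_range_coprod hv (Or.inl htop)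
    · obtain ⟨l, hl0, hl⟩ := Submodule.exists_dual_ne_zero_le_ker htop
      filter_upwards [ae_restrict_mem hU'.measurableSet, hr' l hl0] with w hw hlw
      rw [hder (v, w) ⟨hvU, hw⟩]
      exact min_succ_le_finrank_range_coprod hv (Or.inr ⟨l, hl, hlw⟩)
  · rw [Measure.conv]
    refine ((hρ.prod hm).map measurable_add).trans ?_
    rw [Measure.prod_sum, Measure.map_sum measurable_add.aemeasurable]
    refine Measure.absolutelyContinuous_of_le (le_of_eq ?_)
    congr 1
    ext1 i
    rw [Measure.map_prod_map _ _ (hγ i.1).2.1 (hγ' i.2).2.1, Measure.map_map measurable_add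
      ((hγ i.1).2.1.prodMap (hγ' i.2).2.1), Measure.prod_restrict]
    rfl

end Convolution

/-! ### Analytic submanifolds -/

section Submanifold

open Set Filter Topology Module Metric

/-- Around each of its points, an analytic submanifold is the image of a ball under an analytic
Lipschitz map. -/
theorem IsAnalyticSubmanifold.exists_chart {E : Type*} [NormedAddCommGroup E] [NormedSpace ℝ E]
    [FiniteDimensional ℝ E] {d : ℕ} {M : Set E} (hM : IsAnalyticSubmanifold d M) {p : E}
    (hp : p ∈ M) :
    ∃ (u₀ : EuclideanSpace ℝ (Fin d)) (r : ℝ) (γ : EuclideanSpace ℝ (Fin d) → E) (C : NNReal),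
      0 < r ∧ AnalyticOnNhd ℝ γ (ball u₀ r) ∧ LipschitzOnWith C γ (ball u₀ r) ∧
      γ '' ball u₀ r ⊆ M ∧ γ '' ball u₀ r ∈ 𝓝[M] p := by
  obtain ⟨S, Φ, hS, hpΦ, hΦ, hΦ', hMS⟩ := hM p hp
  let e : EuclideanSpace ℝ (Fin d) ≃L[ℝ] S :=
    ContinuousLinearEquiv.ofFinrankEq (by rw [hS, finrank_euclideanSpace_fin])
  let j : EuclideanSpace ℝ (Fin d) →L[ℝ] E := S.subtypeL ∘L (e : EuclideanSpace ℝ (Fin d) →L[ℝ] S)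
  let u₀ : EuclideanSpace ℝ (Fin d) := e.symm ⟨Φ p, (hMS p hpΦ).mp hp⟩
  have hju₀ : j u₀ = Φ p := by simp [j, u₀]
  let γ : EuclideanSpace ℝ (Fin d) → E := fun u => Φ.symm (j u)
  have hγ : AnalyticOnNhd ℝ γ (j ⁻¹' Φ.target) := fun u hu =>
    (hΦ' (j u) hu).comp (j.analyticAt u)
  have hu₀ : u₀ ∈ j ⁻¹' Φ.target := by
    rw [mem_preimage, hju₀]
    exact Φ.map_source hpΦ
  obtain ⟨C, t, ht, hC⟩ := ((hγ u₀ hu₀).contDiffAt (n := 1)).exists_lipschitzOnWith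
  obtain ⟨r, hr, hrt⟩ := Metric.mem_nhds_iff.mp
    (inter_mem ht ((Φ.open_target.preimage j.continuous).mem_nhds hu₀))
  refine ⟨u₀, r, γ, C, hr, hγ.mono fun u hu => (hrt hu).2, hC.mono fun u hu => (hrt hu).1, ?_, ?_⟩
  · rintro _ ⟨u, hu, rfl⟩
    have hut : j u ∈ Φ.target := (hrt hu).2
    rw [hMS _ (Φ.map_target hut), Φ.right_inv hut]
    exact (e u).2
  · have ho : IsOpen (e.symm ⁻¹' ball u₀ r) := isOpen_ball.preimage e.symm.continuous
    obtain ⟨O, hO, hOS⟩ := isOpen_induced_iff.mp ho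
    have hpO : Φ p ∈ O := by
      have : (⟨Φ p, (hMS p hpΦ).mp hp⟩ : S) ∈ (Subtype.val ⁻¹' O : Set S) := by
        rw [hOS]
        exact mem_ball_self hr
      exact this
    have h1 : Φ.source ∩ Φ ⁻¹' O ∈ 𝓝 p :=
      (Φ.isOpen_inter_preimage hO).mem_nhds ⟨hpΦ, hpO⟩
    filter_upwards [mem_nhdsWithin_of_mem_nhds h1, self_mem_nhdsWithin] with x hx hxM
    have hxS := (hMS x hx.1).mp hxM
    have hx2 : (⟨Φ x, hxS⟩ : S) ∈ e.symm ⁻¹' ball u₀ r := by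
      rw [← hOS]
      exact hx.2
    refine ⟨e.symm ⟨Φ x, hxS⟩, hx2, ?_⟩
    simp [γ, j, Φ.left_inv hx.1]

/-- If a linear functional is constant near one point of a connected analytic submanifold, then the
submanifold is contained in a level set: the locus where the functional is locally equal to the
constant is open and closed in the submanifold, by the identity theorem in charts. -/
theorem IsAnalyticSubmanifold.forall_eq_of_eventually_eq {E : Type*} [NormedAddCommGroup E]
    [NormedSpace ℝ E] [FiniteDimensional ℝ E] {d : ℕ} {M : Set E} (hM : IsAnalyticSubmanifold d M)
    (hconn : IsPreconnected M) (l : E →L[ℝ] ℝ) (c : ℝ) {p : E} (hp : p ∈ M)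
    (hpc : ∀ᶠ q in 𝓝[M] p, l q = c) : ∀ q ∈ M, l q = c := by
  let O : Set M := {q | ∀ᶠ q' in 𝓝[M] (q : E), l q' = c}
  have hO : IsOpen O := by
    rw [isOpen_iff_mem_nhds]
    intro q hq
    have h1 : ∀ᶠ y in 𝓝[M] (q : E), ∀ᶠ x in 𝓝[M] y, l x = c :=
      eventually_eventually_nhdsWithin.mpr hq
    rw [nhds_subtype_eq_comap_nhdsWithin]
    exact ⟨_, h1, fun y hy => hy⟩
  have hOc : IsClosed O := by
    rw [← isOpen_compl_iff, isOpen_iff_mem_nhds]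
    intro q hq
    obtain ⟨u₀, r, γ, C, hr, hγ, -, hγM, hγq⟩ := hM.exists_chart q.2
    rw [nhds_subtype_eq_comap_nhdsWithin]
    refine ⟨_, hγq, fun y hy hyO => hq ?_⟩
    obtain ⟨u, hu, huy⟩ := hy
    have hev : (fun v => l (γ v)) =ᶠ[𝓝 u] fun _ => c := by
      have hcont : Tendsto γ (𝓝 u) (𝓝[M] (y : E)) := by
        rw [← huy]
        refine tendsto_nhdsWithin_of_tendsto_nhds_of_eventually_within _
          (hγ u hu).continuousAt ?_
        filter_upwards [isOpen_ball.mem_nhds hu] with v hv using hγM ⟨v, hv, rfl⟩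
      exact hcont.eventually hyO
    have heq : EqOn (fun v => l (γ v)) (fun _ => c) (ball u₀ r) :=
      AnalyticOnNhd.eqOn_of_preconnected_of_eventuallyEq
        (fun v hv => (l.analyticAt _).comp (hγ v hv)) analyticOnNhd_const
        (convex_ball u₀ r).isPreconnected hu hev
    refine Filter.mem_of_superset hγq ?_
    rintro _ ⟨v, hv, rfl⟩
    exact heq hv
  have : PreconnectedSpace M := Subtype.preconnectedSpace hconn
  intro q hq
  have huniv : O = univ := IsClopen.eq_univ ⟨hOc, hO⟩ ⟨⟨p, hp⟩, hpc⟩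
  have hqO : (⟨q, hq⟩ : M) ∈ O := huniv ▸ mem_univ _
  exact mem_of_mem_nhdsWithin (t := {q' | l q' = c}) hq hqO

/-- The tangent spaces of a connected analytic submanifold that lies in no affine hyperplane are, in
every chart, almost everywhere not contained in a given linear hyperplane. -/
theorem IsAnalyticSubmanifold.ae_comp_fderiv_ne_zero {E : Type*} [NormedAddCommGroup E]
    [NormedSpace ℝ E] [FiniteDimensional ℝ E] {d : ℕ} {M : Set E} (hM : IsAnalyticSubmanifold d M)
    (hconn : IsPreconnected M) (hplane : ∀ H : Set E, IsAffineHyperplane H → ¬ M ⊆ H)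
    {u₀ : EuclideanSpace ℝ (Fin d)} {r : ℝ} {γ : EuclideanSpace ℝ (Fin d) → E} (hr : 0 < r)
    (hγ : AnalyticOnNhd ℝ γ (ball u₀ r)) {p : E} (hp : p ∈ M) (hγp : γ '' ball u₀ r ∈ 𝓝[M] p)
    {l : E →L[ℝ] ℝ} (hl : l ≠ 0) :
    ∀ᵐ u ∂volume.restrict (ball u₀ r), l ∘L fderiv ℝ γ u ≠ 0 := by
  have hA : AnalyticOnNhd ℝ (fun u => l ∘L fderiv ℝ γ u) (ball u₀ r) := fun u hu =>
    ((ContinuousLinearMap.compL ℝ (EuclideanSpace ℝ (Fin d)) E ℝ l).analyticAt _).comp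
      (hγ.fderiv u hu)
  rw [ae_restrict_iff' isOpen_ball.measurableSet]
  by_cases hz : ∀ u ∈ ball u₀ r, l ∘L fderiv ℝ γ u = 0
  · exfalso
    have hconst : ∀ u ∈ ball u₀ r, l (γ u) = l (γ u₀) := by
      intro u hu
      have hd : ∀ v ∈ ball u₀ r, HasFDerivAt (fun v => l (γ v)) (l ∘L fderiv ℝ γ v) v :=
        fun v hv => l.hasFDerivAt.comp v (hγ v hv).differentiableAt.hasFDerivAt
      refine (convex_ball u₀ r).is_const_of_fderivWithin_eq_zero (𝕜 := ℝ)
        (fun v hv => (hd v hv).differentiableAt.differentiableWithinAt) (fun v hv => ?_) hu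
        (mem_ball_self hr)
      rw [fderivWithin_of_isOpen isOpen_ball hv, (hd v hv).fderiv, hz v hv]
    have hall := hM.forall_eq_of_eventually_eq hconn l (l (γ u₀)) hp
      (Filter.mem_of_superset hγp (by rintro _ ⟨v, hv, rfl⟩; exact hconst v hv))
    refine hplane {x | l x = l (γ u₀)} ⟨l, l (γ u₀), ?_, rfl⟩ hall
    intro h
    exact hl (ContinuousLinearMap.coe_injective h)
  · push Not at hz
    obtain ⟨x₀, hx₀, h0⟩ := hz
    have := measure_zeros_of_analyticOnNhd volume isOpen_ball (convex_ball u₀ r) hA hx₀ h0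
    rw [measure_eq_zero_iff_ae_notMem] at this
    filter_upwards [this] with u hu hur h
    exact hu ⟨hur, h⟩

theorem LipschitzOnWith.euclideanHausdorffMeasure_image_le {d : ℕ} {E : Type*}
    [NormedAddCommGroup E] [MeasurableSpace E] [BorelSpace E] {C : NNReal}
    {γ : EuclideanSpace ℝ (Fin d) → E} {A : Set (EuclideanSpace ℝ (Fin d))}
    (h : LipschitzOnWith C γ A) :
    Measure.euclideanHausdorffMeasure d (γ '' A) ≤ (C : ENNReal) ^ (d : ℝ) * volume A := by
  rw [← EuclideanSpace.euclideanHausdorffMeasure_eq_volume]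
  simp only [Measure.euclideanHausdorffMeasure_def, Measure.smul_apply]
  calc _ ≤ _ • ((C : ENNReal) ^ (d : ℝ) * Measure.hausdorffMeasure d A) := by
        gcongr
        exact h.hausdorffMeasure_image_le (Nat.cast_nonneg d)
    _ = _ := by rw [ENNReal.smul_def, ENNReal.smul_def, smul_eq_mul, smul_eq_mul]; ring

theorem IsAnalyticSubmanifold.euclideanHausdorffMeasure_lt_top {E : Type*} [NormedAddCommGroup E]
    [NormedSpace ℝ E] [FiniteDimensional ℝ E] [MeasurableSpace E] [BorelSpace E] {d : ℕ}
    {M K : Set E} (hM : IsAnalyticSubmanifold d M) (hK : IsCompact K) (hKM : K ⊆ M) :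
    Measure.euclideanHausdorffMeasure d K < ⊤ := by
  refine hK.measure_lt_top_of_nhdsWithin fun p hp => ?_
  obtain ⟨u₀, r, γ, C, hr, hγ, hC, hγM, hγp⟩ := hM.exists_chart (hKM hp)
  refine ⟨γ '' ball u₀ r, nhdsWithin_mono _ hKM hγp,
    hC.euclideanHausdorffMeasure_image_le.trans_lt ?_⟩
  exact ENNReal.mul_lt_top (by simp) measure_ball_lt_top

/-- The surface measure of a connected analytic submanifold in no affine hyperplane is
transversal. -/
theorem isTransversal_surfaceMeasure {n d : ℕ} {M : Set (PhaseSpace n)}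
    (hM : IsAnalyticSubmanifold d M) (hconn : IsPreconnected M)
    (hplane : ∀ H : Set (PhaseSpace n), IsAffineHyperplane H → ¬ M ⊆ H) :
    IsTransversal (surfaceMeasure d M) := by
  classical
  choose! u₀ r γ C hr hγ hC hγM hγp using fun (p : PhaseSpace n) (hp : p ∈ M) => hM.exists_chart hp
  obtain ⟨t, htM, htc, hMt⟩ := TopologicalSpace.countable_cover_nhdsWithin hγp
  -- Charts are extended by zero, to be measurable on the whole parameter space.
  let g : PhaseSpace n → EuclideanSpace ℝ (Fin d) → PhaseSpace n := fun p =>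
    (ball (u₀ p) (r p)).indicator (γ p)
  have hg : ∀ p, EqOn (g p) (γ p) (ball (u₀ p) (r p)) := fun p => eqOn_indicator
  have hgm : ∀ p ∈ M, Measurable (g p) := fun p hp => by
    simp only [g, ← piecewise_eq_indicator]
    exact (hγ p hp).continuousOn.measurable_piecewise continuousOn_const isOpen_ball.measurableSet
  refine ⟨EuclideanSpace ℝ (Fin d), inferInstance, inferInstance, inferInstance, inferInstance,
    inferInstance, volume, inferInstance, t, htc.to_subtype, fun p => ball (u₀ p) (r p),
    fun p => g p, fun p => ⟨isOpen_ball, hgm p (htM p.2), ?_, fun l hl => ?_⟩, ?_⟩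
  · exact ((hγ p (htM p.2)).contDiffOn (isOpen_ball.uniqueDiffOn)).congr (hg p)
  · filter_upwards [hM.ae_comp_fderiv_ne_zero hconn hplane (hr p (htM p.2)) (hγ p (htM p.2))
      (htM p.2) (hγp p (htM p.2)) hl, ae_restrict_mem isOpen_ball.measurableSet] with u hu hub
    rwa [((hg p).eventuallyEq_of_mem (isOpen_ball.mem_nhds hub)).fderiv_eq]
  · refine Measure.AbsolutelyContinuous.mk fun N hN h0 => ?_
    rw [Measure.sum_apply _ hN, ENNReal.tsum_eq_zero] at h0
    rw [surfaceMeasure, Measure.restrict_apply hN]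
    have hcover : N ∩ M ⊆ ⋃ p ∈ t, γ p '' ball (u₀ p) (r p) ∩ N := fun x hx => by
      obtain ⟨p, hp, hxp⟩ := mem_iUnion₂.mp (hMt hx.2)
      exact mem_iUnion₂.mpr ⟨p, hp, hxp, hx.1⟩
    refine measure_mono_null hcover ((measure_biUnion_null_iff htc).mpr fun p hp => ?_)
    have h1 := h0 ⟨p, hp⟩
    rw [Measure.map_apply (hgm p (htM hp)) hN,
      Measure.restrict_apply (hgm p (htM hp) hN)] at h1
    have h2 : γ p '' ball (u₀ p) (r p) ∩ N ⊆ γ p '' (g p ⁻¹' N ∩ ball (u₀ p) (r p)) := by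
      rintro _ ⟨⟨u, hu, rfl⟩, huN⟩
      exact ⟨u, ⟨by rw [mem_preimage, hg p hu]; exact huN, hu⟩, rfl⟩
    refine measure_mono_null h2 (le_antisymm ?_ zero_le)
    refine ((hC p (htM hp)).mono inter_subset_right).euclideanHausdorffMeasure_image_le.trans ?_
    rw [h1, mul_zero]

end Submanifold

/-! ### Phase space shifts -/

section Shifts

open Set Filter Topology

variable {n : ℕ}

theorem L2Space.norm_sq_eq_integral (f : L2Space n) : ‖f‖ ^ 2 = ∫ t, ‖f t‖ ^ 2 := by
  have h : ((‖f‖ ^ 2 : ℝ) : ℂ) = ((∫ t, ‖f t‖ ^ 2 : ℝ) : ℂ) := by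
    rw [← integral_complex_ofReal, Complex.ofReal_pow, ← Complex.coe_algebraMap,
      ← inner_self_eq_norm_sq_to_K (𝕜 := ℂ) f, L2.inner_def]
    refine integral_congr_ae (Eventually.of_forall fun t => ?_)
    simp [inner_self_eq_norm_sq_to_K]
  exact_mod_cast h

/-- The unimodular factor of `weylIntegrand`. -/
noncomputable def weylPhase (p : PhaseSpace n) (t : EuclideanSpace ℝ (Fin n)) : ℂ :=
  Complex.exp (Real.pi * Complex.I * ((⟪p.fst, p.snd⟫_ℝ + 2 * ⟪p.snd, t⟫_ℝ : ℝ) : ℂ))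

theorem norm_weylPhase (p : PhaseSpace n) (t : EuclideanSpace ℝ (Fin n)) :
    ‖weylPhase p t‖ = 1 := by
  rw [weylPhase, mul_right_comm, ← Complex.ofReal_mul, Complex.norm_exp_ofReal_mul_I]

theorem continuous_fst_phaseSpace : Continuous fun p : PhaseSpace n => p.fst :=
  (WithLp.prod_continuous_ofLp 2 _ _).fst

theorem continuous_snd_phaseSpace : Continuous fun p : PhaseSpace n => p.snd :=
  (WithLp.prod_continuous_ofLp 2 _ _).snd

theorem continuous_weylPhase :
    Continuous fun q : PhaseSpace n × EuclideanSpace ℝ (Fin n) => weylPhase q.1 q.2 := by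
  have h1 : Continuous fun q : PhaseSpace n × EuclideanSpace ℝ (Fin n) => q.1.fst :=
    continuous_fst_phaseSpace.comp continuous_fst
  have h2 : Continuous fun q : PhaseSpace n × EuclideanSpace ℝ (Fin n) => q.1.snd :=
    continuous_snd_phaseSpace.comp continuous_fst
  unfold weylPhase
  fun_prop

theorem memLp_weylPhase_mul (p : PhaseSpace n) (f : L2Space n) :
    MemLp (fun t => weylPhase p t * f t) 2 volume := by
  refine (Lp.memLp f).of_le ?_ (Eventually.of_forall fun t => by simp [norm_weylPhase])
  exact ((continuous_weylPhase.comp (Continuous.prodMk_right p)).aestronglyMeasurable).mul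
    (Lp.aestronglyMeasurable f)

/-- Multiplication by `weylPhase p` on `L²(ℝⁿ)`. -/
noncomputable def modulation (p : PhaseSpace n) : L2Space n →ₗᵢ[ℂ] L2Space n where
  toFun f := (memLp_weylPhase_mul p f).toLp _
  map_add' f g := by
    rw [← MemLp.toLp_add]
    refine MemLp.toLp_congr _ _ ?_
    filter_upwards [Lp.coeFn_add f g] with t ht
    simp only [ht, Pi.add_apply, mul_add]
  map_smul' c f := by
    rw [RingHom.id_apply, ← MemLp.toLp_const_smul]
    refine MemLp.toLp_congr _ _ ?_
    filter_upwards [Lp.coeFn_smul c f] with t ht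
    simp only [ht, Pi.smul_apply, smul_eq_mul]
    ring
  norm_map' f := by
    change ‖(memLp_weylPhase_mul p f).toLp _‖ = ‖f‖
    rw [Lp.norm_toLp, Lp.norm_def]
    congr 1
    exact eLpNorm_congr_norm_ae (Eventually.of_forall fun t => by simp [norm_weylPhase])

theorem coeFn_modulation (p : PhaseSpace n) (f : L2Space n) :
    modulation p f =ᵐ[volume] fun t => weylPhase p t * f t :=
  (memLp_weylPhase_mul p f).coeFn_toLp

theorem continuous_modulation (f : L2Space n) :
    Continuous fun p : PhaseSpace n => modulation p f := by
  rw [continuous_iff_continuousAt]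
  intro p₀
  rw [ContinuousAt, tendsto_iff_norm_sub_tendsto_zero]
  have hsq : ∀ p : PhaseSpace n, ‖modulation p f - modulation p₀ f‖ ^ 2 =
      ∫ t, ‖(weylPhase p t - weylPhase p₀ t) * f t‖ ^ 2 := by
    intro p
    rw [L2Space.norm_sq_eq_integral]
    refine integral_congr_ae ?_
    filter_upwards [Lp.coeFn_sub (modulation p f) (modulation p₀ f), coeFn_modulation p f,
      coeFn_modulation p₀ f] with t h2 h3 h4
    rw [h2, Pi.sub_apply, h3, h4, sub_mul]
  have hlim : Tendsto (fun p : PhaseSpace n => ‖modulation p f - modulation p₀ f‖ ^ 2) (𝓝 p₀)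
      (𝓝 0) := by
    simp_rw [hsq]
    have : (0 : ℝ) = ∫ t, ‖(weylPhase p₀ t - weylPhase p₀ t) * f t‖ ^ 2 := by simp
    rw [this]
    refine tendsto_integral_filter_of_dominated_convergence (fun t => 4 * ‖f t‖ ^ 2) ?_ ?_ ?_ ?_
    · refine Eventually.of_forall fun p => ?_
      refine AEStronglyMeasurable.pow (AEStronglyMeasurable.norm (AEStronglyMeasurable.mul ?_
        (Lp.aestronglyMeasurable f))) 2
      exact ((continuous_weylPhase.comp (Continuous.prodMk_right p)).sub
        (continuous_weylPhase.comp (Continuous.prodMk_right p₀))).aestronglyMeasurable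
    · refine Eventually.of_forall fun p => Eventually.of_forall fun t => ?_
      rw [norm_pow, norm_norm, norm_mul, mul_pow]
      have h1 : ‖weylPhase p t - weylPhase p₀ t‖ ≤ 2 := by
        refine (norm_sub_le _ _).trans ?_
        rw [norm_weylPhase, norm_weylPhase]; norm_num
      have h2 : ‖weylPhase p t - weylPhase p₀ t‖ ^ 2 ≤ 2 ^ 2 :=
        pow_le_pow_left₀ (norm_nonneg _) h1 2
      gcongr
      linarith
    · exact ((memLp_two_iff_integrable_sq_norm (Lp.aestronglyMeasurable f)).mp
        (Lp.memLp f)).const_mul 4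
    · refine Eventually.of_forall fun t => ?_
      have hc : Continuous fun p : PhaseSpace n =>
          ‖(weylPhase p t - weylPhase p₀ t) * f t‖ ^ 2 :=
        ((((continuous_weylPhase.comp (Continuous.prodMk_left t)).sub continuous_const).mul
          continuous_const).norm).pow 2
      exact hc.tendsto p₀
  have := hlim.sqrt
  simpa using this

/-- Translation by `x` on `L²(ℝⁿ)`. -/
noncomputable def translation (x : EuclideanSpace ℝ (Fin n)) : L2Space n →ₗᵢ[ℂ] L2Space n :=
  Lp.compMeasurePreservingₗᵢ ℂ (fun t => t + x) (measurePreserving_add_right volume x)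

theorem coeFn_translation (x : EuclideanSpace ℝ (Fin n)) (f : L2Space n) :
    translation x f =ᵐ[volume] fun t => f (t + x) :=
  Lp.coeFn_compMeasurePreserving f (measurePreserving_add_right volume x)

theorem continuous_translation (f : L2Space n) :
    Continuous fun x : EuclideanSpace ℝ (Fin n) => translation x f := by
  let g : C(EuclideanSpace ℝ (Fin n), C(EuclideanSpace ℝ (Fin n), EuclideanSpace ℝ (Fin n))) :=
    (ContinuousMap.mk (fun a : EuclideanSpace ℝ (Fin n) × EuclideanSpace ℝ (Fin n) => a.2 + a.1)
      (by fun_prop)).curry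
  exact (continuous_const (y := f)).compMeasurePreservingLp g.continuous
    (fun x => measurePreserving_add_right volume x) (by norm_num)

/-- The phase space shift by `p = (x, y)`: the unitary operator
`φ ↦ exp(πi (x ⬝ y + 2 y ⬝ t)) φ(t + x)` on `L²(ℝⁿ)`. -/
noncomputable def weylShift (p : PhaseSpace n) : L2Space n →ₗᵢ[ℂ] L2Space n :=
  (modulation p).comp (translation p.fst)

theorem coeFn_weylShift (p : PhaseSpace n) (f : L2Space n) :
    weylShift p f =ᵐ[volume] fun t => weylIntegrand f t p := by
  filter_upwards [coeFn_modulation p (translation p.fst f), coeFn_translation p.fst f] with t h1 h2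
  change modulation p (translation p.fst f) t = _
  rw [h1, h2]
  rfl

theorem continuous_weylShift (f : L2Space n) :
    Continuous fun p : PhaseSpace n => weylShift p f := by
  rw [continuous_iff_continuousAt]
  intro p₀
  rw [ContinuousAt, tendsto_iff_norm_sub_tendsto_zero]
  have h1 : Tendsto (fun p : PhaseSpace n => ‖translation p.fst f - translation p₀.fst f‖ +
      ‖modulation p (translation p₀.fst f) - modulation p₀ (translation p₀.fst f)‖) (𝓝 p₀)
      (𝓝 (0 + 0)) := by
    refine Tendsto.add ?_ ?_
    · rw [← tendsto_iff_norm_sub_tendsto_zero]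
      exact ((continuous_translation f).comp continuous_fst_phaseSpace).tendsto p₀
    · rw [← tendsto_iff_norm_sub_tendsto_zero]
      exact (continuous_modulation _).tendsto p₀
  rw [add_zero] at h1
  refine squeeze_zero (fun _ => norm_nonneg _) (fun p => ?_) h1
  have h2 : weylShift p f - weylShift p₀ f =
      modulation p (translation p.fst f - translation p₀.fst f) +
        (modulation p (translation p₀.fst f) - modulation p₀ (translation p₀.fst f)) := by
    rw [map_sub]
    change modulation p (translation p.fst f) - modulation p₀ (translation p₀.fst f) = _
    abel
  rw [h2]
  refine (norm_add_le _ _).trans_eq ?_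
  rw [LinearIsometry.norm_map]

/-- The cocycle of the projective representation `p ↦ weylShift p`. -/
noncomputable def weylCocycle (p q : PhaseSpace n) : ℂ :=
  Complex.exp (Real.pi * Complex.I * ((⟪p.fst, q.snd⟫_ℝ - ⟪q.fst, p.snd⟫_ℝ : ℝ) : ℂ))

theorem norm_weylCocycle (p q : PhaseSpace n) : ‖weylCocycle p q‖ = 1 := by
  rw [weylCocycle, mul_right_comm, ← Complex.ofReal_mul, Complex.norm_exp_ofReal_mul_I]

theorem continuous_weylCocycle :
    Continuous fun q : PhaseSpace n × PhaseSpace n => weylCocycle q.1 q.2 := by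
  have h1 := (continuous_fst_phaseSpace (n := n)).comp (continuous_fst (Y := PhaseSpace n))
  have h2 := (continuous_snd_phaseSpace (n := n)).comp (continuous_fst (Y := PhaseSpace n))
  have h3 := (continuous_fst_phaseSpace (n := n)).comp (continuous_snd (X := PhaseSpace n))
  have h4 := (continuous_snd_phaseSpace (n := n)).comp (continuous_snd (X := PhaseSpace n))
  simp only [Function.comp_def] at h1 h2 h3 h4
  unfold weylCocycle
  fun_prop

/-- The Weyl relations: `p ↦ weylShift p` is a projective representation of `ℝ²ⁿ`. -/
theorem weylShift_weylShift (p q : PhaseSpace n) (f : L2Space n) :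
    weylShift p (weylShift q f) = weylCocycle p q • weylShift (p + q) f := by
  apply Lp.ext
  have h1 : (fun t => weylShift q f (t + p.fst)) =ᵐ[volume]
      fun t => weylIntegrand f (t + p.fst) q :=
    (measurePreserving_add_right volume p.fst).quasiMeasurePreserving.ae_eq_comp
      (coeFn_weylShift q f)
  filter_upwards [coeFn_weylShift p (weylShift q f), coeFn_weylShift (p + q) f, h1,
    Lp.coeFn_smul (weylCocycle p q) (weylShift (p + q) f)] with t h2 h3 h4 h5
  rw [h2, h5, Pi.smul_apply, h3, weylIntegrand, h4]
  simp only [weylIntegrand, weylCocycle, smul_eq_mul, WithLp.add_fst, WithLp.add_snd]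
  rw [← mul_assoc, ← mul_assoc, ← Complex.exp_add, ← Complex.exp_add]
  congr 2
  · rw [← mul_add, ← mul_add, ← Complex.ofReal_add, ← Complex.ofReal_add]
    congr 2
    have hc : ⟪q.snd, p.fst⟫_ℝ = ⟪p.fst, q.snd⟫_ℝ := real_inner_comm _ _
    simp only [inner_add_left, inner_add_right, hc]
    ring
  · rw [add_assoc]

theorem weylShift_zero (f : L2Space n) : weylShift 0 f = f := by
  apply Lp.ext
  filter_upwards [coeFn_weylShift 0 f] with t h
  rw [h]
  simp [weylIntegrand]

theorem inner_weylShift_left (p : PhaseSpace n) (f g : L2Space n) :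
    ⟪weylShift p f, g⟫_ℂ = ⟪f, weylShift (-p) g⟫_ℂ := by
  have h : g = weylShift p (weylShift (-p) g) := by
    rw [weylShift_weylShift, add_neg_cancel, weylShift_zero]
    simp [weylCocycle]
  conv_lhs => rw [h]
  exact (weylShift p).inner_map_map _ _

end Shifts

/-! ### Superpositions of phase space shifts -/

section Superpositions

open Set Filter Topology

variable {n : ℕ} {X : Type*} [MeasurableSpace X]

theorem stronglyMeasurable_weylShift {F : X → PhaseSpace n} (hF : Measurable F) (φ : L2Space n) :
    StronglyMeasurable fun x => weylShift (F x) φ :=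
  (continuous_weylShift φ).stronglyMeasurable.comp_measurable hF

theorem integrable_smul_weylShift {m : Measure X} {F : X → PhaseSpace n} (hF : Measurable F)
    {c : X → ℂ} (hc : Integrable c m) (φ : L2Space n) :
    Integrable (fun x => c x • weylShift (F x) φ) m := by
  refine (hc.norm.mul_const ‖φ‖).mono' (hc.aestronglyMeasurable.smul
    (stronglyMeasurable_weylShift hF φ).aestronglyMeasurable) (Eventually.of_forall fun x => ?_)
  rw [norm_smul, LinearIsometry.norm_map]

/-- The operator `∫ c(x) π(F x) dm(x)`, where `π` denotes the phase space shifts and the integral is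
taken in the strong sense. The hypotheses make the integral converge. -/
noncomputable def weylSuperposition (m : Measure X) {F : X → PhaseSpace n} (hF : Measurable F)
    {c : X → ℂ} (hc : Integrable c m) : L2Space n →L[ℂ] L2Space n :=
  LinearMap.mkContinuous
    { toFun := fun φ => ∫ x, c x • weylShift (F x) φ ∂m
      map_add' := fun φ χ => by
        rw [← integral_add (integrable_smul_weylShift hF hc φ) (integrable_smul_weylShift hF hc χ)]
        simp only [map_add, smul_add]
      map_smul' := fun a φ => by
        rw [RingHom.id_apply, ← integral_smul]
        simp only [map_smul, smul_comm a] }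
    (∫ x, ‖c x‖ ∂m) fun φ => by
      refine (norm_integral_le_integral_norm _).trans_eq ?_
      simp only [norm_smul, LinearIsometry.norm_map]
      exact integral_mul_const _ _

theorem weylSuperposition_apply (m : Measure X) {F : X → PhaseSpace n} (hF : Measurable F)
    {c : X → ℂ} (hc : Integrable c m) (φ : L2Space n) :
    weylSuperposition m hF hc φ = ∫ x, c x • weylShift (F x) φ ∂m := rfl

theorem norm_weylSuperposition_le (m : Measure X) {F : X → PhaseSpace n} (hF : Measurable F)
    {c : X → ℂ} (hc : Integrable c m) : ‖weylSuperposition m hF hc‖ ≤ ∫ x, ‖c x‖ ∂m :=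
  LinearMap.mkContinuous_norm_le _ (integral_nonneg fun _ => norm_nonneg _) _

theorem weylSuperposition_add (m : Measure X) {F : X → PhaseSpace n} (hF : Measurable F)
    {c c' : X → ℂ} (hc : Integrable c m) (hc' : Integrable c' m) :
    weylSuperposition m hF (hc.add hc') =
      weylSuperposition m hF hc + weylSuperposition m hF hc' := by
  ext1 φ
  simp only [weylSuperposition_apply, add_apply, Pi.add_apply, add_smul]
  exact integral_add (integrable_smul_weylShift hF hc φ) (integrable_smul_weylShift hF hc' φ)

theorem weylSuperposition_congr (m : Measure X) {F : X → PhaseSpace n} (hF : Measurable F)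
    {c c' : X → ℂ} (hc : Integrable c m) (hc' : Integrable c' m) (h : c =ᵐ[m] c') :
    weylSuperposition m hF hc = weylSuperposition m hF hc' := by
  ext1 φ
  simp only [weylSuperposition_apply]
  exact integral_congr_ae (h.mono fun x hx => by simp only [hx])

theorem norm_weylSuperposition_sub_le (m : Measure X) {F : X → PhaseSpace n} (hF : Measurable F)
    {c c' : X → ℂ} (hc : Integrable c m) (hc' : Integrable c' m) :
    ‖weylSuperposition m hF hc - weylSuperposition m hF hc'‖ ≤ ∫ x, ‖c x - c' x‖ ∂m := by
  have h : weylSuperposition m hF hc - weylSuperposition m hF hc' =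
      weylSuperposition m hF (hc.sub hc') := by
    rw [sub_eq_iff_eq_add, ← weylSuperposition_add]
    exact weylSuperposition_congr m hF _ _ (Eventually.of_forall fun x => by simp)
  rw [h]
  exact norm_weylSuperposition_le m hF _

theorem adjoint_weylSuperposition (m : Measure X) {F : X → PhaseSpace n} (hF : Measurable F)
    {c : X → ℂ} (hc : Integrable c m) (hc' : Integrable (fun x => (starRingEnd ℂ) (c x)) m) :
    ContinuousLinearMap.adjoint (weylSuperposition m hF hc) =
      weylSuperposition m (F := fun x => -F x) hF.neg hc' := by
  symm
  rw [ContinuousLinearMap.eq_adjoint_iff]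
  intro φ χ
  rw [weylSuperposition_apply, weylSuperposition_apply,
    ← integral_inner (integrable_smul_weylShift hF hc χ) φ, ← inner_conj_symm,
    ← integral_inner (integrable_smul_weylShift (F := fun x => -F x) hF.neg hc' φ) χ,
    ← integral_conj]
  refine integral_congr_ae (Eventually.of_forall fun x => ?_)
  simp only [inner_smul_right, map_mul, inner_conj_symm, Complex.conj_conj]
  rw [inner_weylShift_left, neg_neg]

theorem weylSuperposition_comp {Y : Type*} [MeasurableSpace Y] (m : Measure X) [SFinite m]
    {F : X → PhaseSpace n} (hF : Measurable F) {c : X → ℂ} (hc : Integrable c m) (m' : Measure Y)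
    [SFinite m'] {G : Y → PhaseSpace n} (hG : Measurable G) {c' : Y → ℂ} (hc' : Integrable c' m')
    (hFG : Measurable fun z : X × Y => F z.1 + G z.2)
    (hcc' : Integrable (fun z : X × Y => c z.1 * c' z.2 * weylCocycle (F z.1) (G z.2))
      (m.prod m')) :
    weylSuperposition m hF hc ∘L weylSuperposition m' hG hc' =
      weylSuperposition (m.prod m') hFG hcc' := by
  ext1 φ
  rw [ContinuousLinearMap.comp_apply, weylSuperposition_apply, weylSuperposition_apply,
    weylSuperposition_apply, integral_prod _ (integrable_smul_weylShift hFG hcc' φ)]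
  refine integral_congr_ae (Eventually.of_forall fun x => ?_)
  have h1 := (weylShift (F x)).toContinuousLinearMap.integral_comp_comm
    (integrable_smul_weylShift hG hc' φ)
  simp only [LinearIsometry.coe_toContinuousLinearMap] at h1
  simp only
  rw [← h1, ← integral_smul]
  refine integral_congr_ae (Eventually.of_forall fun y => ?_)
  simp only [map_smul, weylShift_weylShift, smul_smul, mul_assoc]

theorem integrable_mul_weylCocycle {Y : Type*} [MeasurableSpace Y] {m : Measure X}
    {F : X → PhaseSpace n} (hF : Measurable F) {c : X → ℂ} (hc : Integrable c m) {m' : Measure Y}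
    [SFinite m'] {G : Y → PhaseSpace n} (hG : Measurable G) {c' : Y → ℂ} (hc' : Integrable c' m') :
    Integrable (fun z : X × Y => c z.1 * c' z.2 * weylCocycle (F z.1) (G z.2)) (m.prod m') := by
  refine (hc.mul_prod hc').mul_bdd (c := 1) ?_
    (Eventually.of_forall fun z => (norm_weylCocycle _ _).le)
  exact (continuous_weylCocycle.measurable.comp ((hF.comp measurable_fst).prodMk
    (hG.comp measurable_snd))).aestronglyMeasurable

/-- `T = ∫ c(x) π(F x) dm(x)` for a finite measure `m` whose image under `F` is absolutely
continuous with respect to `ρ`. Equivalently, `T` is the Weyl transform of a complex measure that is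
absolutely continuous with respect to `ρ`; the auxiliary space `X` spares disintegrating measures
along addition when operators are composed. -/
def HasWeylSymbol (ρ : Measure (PhaseSpace n)) (T : L2Space n →L[ℂ] L2Space n) : Prop :=
  ∃ (X : Type) (_ : MeasurableSpace X) (m : Measure X) (_ : IsFiniteMeasure m)
    (F : X → PhaseSpace n) (hF : Measurable F) (c : X → ℂ) (hc : Integrable c m),
    m.map F ≪ ρ ∧ T = weylSuperposition m hF hc

theorem HasWeylSymbol.mono {ρ ρ' : Measure (PhaseSpace n)} {T : L2Space n →L[ℂ] L2Space n}
    (h : HasWeylSymbol ρ T) (hρ : ρ ≪ ρ') : HasWeylSymbol ρ' T := by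
  obtain ⟨X, i, m, i', F, hF, c, hc, hm, hT⟩ := h
  exact ⟨X, i, m, i', F, hF, c, hc, hm.trans hρ, hT⟩

theorem HasWeylSymbol.adjoint {ρ : Measure (PhaseSpace n)} {T : L2Space n →L[ℂ] L2Space n}
    (h : HasWeylSymbol ρ T) :
    HasWeylSymbol (ρ.map fun p => -p) (ContinuousLinearMap.adjoint T) := by
  obtain ⟨X, i, m, i', F, hF, c, hc, hm, rfl⟩ := h
  have hc' : Integrable (fun x => (starRingEnd ℂ) (c x)) m :=
    hc.norm.mono' (Complex.continuous_conj.comp_aestronglyMeasurable hc.aestronglyMeasurable)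
      (Eventually.of_forall fun x => by simp)
  refine ⟨X, i, m, i', _, hF.neg, _, hc', ?_, adjoint_weylSuperposition m hF hc hc'⟩
  have := hm.map (f := fun p => -p) measurable_neg
  rwa [Measure.map_map measurable_neg hF] at this

theorem HasWeylSymbol.comp {ρ ρ' : Measure (PhaseSpace n)} [SFinite ρ] [SFinite ρ']
    {T S : L2Space n →L[ℂ] L2Space n} (hT : HasWeylSymbol ρ T) (hS : HasWeylSymbol ρ' S) :
    HasWeylSymbol (ρ.conv ρ') (T ∘L S) := by
  obtain ⟨X, i, m, i', F, hF, c, hc, hm, rfl⟩ := hT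
  obtain ⟨Y, j, m', j', G, hG, c', hc', hm', rfl⟩ := hS
  have hFG : Measurable fun z : X × Y => F z.1 + G z.2 :=
    (hF.comp measurable_fst).add (hG.comp measurable_snd)
  refine ⟨X × Y, inferInstance, m.prod m', inferInstance, _, hFG, _,
    integrable_mul_weylCocycle hF hc hG hc', ?_, weylSuperposition_comp m hF hc m' hG hc' hFG _⟩
  have h1 := (hm.prod hm').map measurable_add
  rw [Measure.map_prod_map m m' hF hG, Measure.map_map measurable_add (hF.prodMap hG)] at h1
  exact h1

theorem HasWeylSymbol.one : HasWeylSymbol (Measure.dirac 0) (1 : L2Space n →L[ℂ] L2Space n) := by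
  refine ⟨Unit, inferInstance, Measure.dirac (), inferInstance, fun _ => 0, measurable_const,
    fun _ => 1, integrable_const _, ?_, ?_⟩
  · rw [Measure.map_const, measure_univ, one_smul]
  · ext1 φ
    rw [weylSuperposition_apply, integral_dirac, weylShift_zero, one_smul]
    rfl

end Superpositions

/-! ### The pointwise formula for superpositions -/

section Pointwise

open Set Filter Topology

variable {n : ℕ} {X : Type*} [MeasurableSpace X]

theorem weylIntegrand_eq (φ : EuclideanSpace ℝ (Fin n) → ℂ) (t : EuclideanSpace ℝ (Fin n))
    (p : PhaseSpace n) : weylIntegrand φ t p = weylPhase p t * φ (t + p.fst) := rfl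

theorem stronglyMeasurable_weylIntegrand {F : X → PhaseSpace n} (hF : Measurable F)
    (φ : L2Space n) :
    StronglyMeasurable fun z : X × EuclideanSpace ℝ (Fin n) => weylIntegrand φ z.2 (F z.1) := by
  have h1 : Measurable fun z : X × EuclideanSpace ℝ (Fin n) => weylPhase (F z.1) z.2 := by
    have hF' : Measurable fun z : X × EuclideanSpace ℝ (Fin n) => (F z.1, z.2) :=
      (hF.comp measurable_fst).prodMk measurable_snd
    have h := continuous_weylPhase.measurable.comp hF'
    simpa only [Function.comp_def] using h
  have h3 : Measurable fun z : X × EuclideanSpace ℝ (Fin n) => (F z.1).fst :=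
    continuous_fst_phaseSpace.measurable.comp (hF.comp measurable_fst)
  have h2 : Measurable fun z : X × EuclideanSpace ℝ (Fin n) => z.2 + (F z.1).fst :=
    Measurable.add (f := fun z : X × EuclideanSpace ℝ (Fin n) => z.2) measurable_snd h3
  simp_rw [weylIntegrand_eq]
  exact h1.stronglyMeasurable.mul ((Lp.stronglyMeasurable φ).comp_measurable h2)

/-- Tonelli's theorem on a set `A` of finite measure, where the `L¹`-norm of a shifted `φ` is at
most `|A| + ‖φ‖²`, uniformly in the shift. -/
theorem integrable_mul_weylIntegrand_prod {m : Measure X} {F : X → PhaseSpace n} (hF : Measurable F)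
    {c : X → ℂ} (hc : Integrable c m) (φ : L2Space n) {A : Set (EuclideanSpace ℝ (Fin n))}
    (hA : volume A < ⊤) :
    Integrable (fun z : X × EuclideanSpace ℝ (Fin n) => c z.1 * weylIntegrand φ z.2 (F z.1))
      (m.prod (volume.restrict A)) := by
  have : IsFiniteMeasure (volume.restrict A) := ⟨by simpa using hA⟩
  have hm : AEStronglyMeasurable
      (fun z : X × EuclideanSpace ℝ (Fin n) => c z.1 * weylIntegrand φ z.2 (F z.1))
      (m.prod (volume.restrict A)) :=
    hc.aestronglyMeasurable.comp_fst.mul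
      (stronglyMeasurable_weylIntegrand hF φ).aestronglyMeasurable
  have hL : ∀ x, MemLp (fun t => weylIntegrand φ t (F x)) 2 (volume.restrict A) := fun x =>
    ((memLp_congr_ae (coeFn_weylShift (F x) φ)).mp (Lp.memLp _)).restrict A
  have hint : ∀ x, Integrable (fun t => weylIntegrand φ t (F x)) (volume.restrict A) := fun x =>
    (hL x).integrable (by norm_num)
  have hsq : ∀ x, Integrable (fun t => ‖weylIntegrand φ t (F x)‖ ^ 2) volume := fun x =>
    (memLp_two_iff_integrable_sq_norm
      (((memLp_congr_ae (coeFn_weylShift (F x) φ)).mp (Lp.memLp _)).aestronglyMeasurable)).mp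
      ((memLp_congr_ae (coeFn_weylShift (F x) φ)).mp (Lp.memLp _))
  have hnorm : ∀ x, ∫ t, ‖weylIntegrand φ t (F x)‖ ^ 2 = ‖φ‖ ^ 2 := fun x => by
    rw [← (weylShift (F x)).norm_map φ, L2Space.norm_sq_eq_integral]
    refine integral_congr_ae ((coeFn_weylShift (F x) φ).mono fun t ht => ?_)
    simp only [ht]
  have hbound : ∀ x, ∫ t in A, ‖weylIntegrand φ t (F x)‖ ≤ volume.real A + ‖φ‖ ^ 2 := by
    intro x
    calc ∫ t in A, ‖weylIntegrand φ t (F x)‖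
        ≤ ∫ t in A, (1 + ‖weylIntegrand φ t (F x)‖ ^ 2) := by
          refine integral_mono (hint x).norm ((integrable_const 1).add (hsq x).restrict)
            fun t => ?_
          nlinarith [sq_nonneg (‖weylIntegrand φ t (F x)‖ - 1)]
      _ = volume.real A + ∫ t in A, ‖weylIntegrand φ t (F x)‖ ^ 2 := by
          rw [integral_add (integrable_const 1) (hsq x).restrict]
          simp
      _ ≤ volume.real A + ‖φ‖ ^ 2 := by
          rw [← hnorm x]
          refine add_le_add_right ?_ _
          exact setIntegral_le_integral (hsq x) (Eventually.of_forall fun t => by positivity)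
  rw [integrable_prod_iff hm]
  refine ⟨Eventually.of_forall fun x => (hint x).const_mul (c x), ?_⟩
  refine (hc.norm.mul_const (volume.real A + ‖φ‖ ^ 2)).mono' hm.norm.integral_prod_right'
    (Eventually.of_forall fun x => ?_)
  rw [Real.norm_of_nonneg (integral_nonneg fun _ => norm_nonneg _)]
  simp only [norm_mul]
  rw [integral_const_mul]
  exact mul_le_mul_of_nonneg_left (hbound x) (norm_nonneg _)

theorem setIntegral_weylSuperposition {m : Measure X} [SFinite m] {F : X → PhaseSpace n}
    (hF : Measurable F) {c : X → ℂ} (hc : Integrable c m) (φ : L2Space n)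
    {A : Set (EuclideanSpace ℝ (Fin n))} (hAm : MeasurableSet A) (hA : volume A < ⊤) :
    ∫ t in A, weylSuperposition m hF hc φ t =
      ∫ t in A, ∫ x, c x * weylIntegrand φ t (F x) ∂m := by
  rw [← L2.inner_indicatorConstLp_one (𝕜 := ℂ) hAm hA.ne, weylSuperposition_apply,
    ← integral_inner (integrable_smul_weylShift hF hc φ),
    ← integral_integral_swap (integrable_mul_weylIntegrand_prod hF hc φ hA)]
  refine integral_congr_ae (Eventually.of_forall fun x => ?_)
  simp only
  rw [inner_smul_right, L2.inner_indicatorConstLp_one, integral_const_mul]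
  congr 1
  exact integral_congr_ae (ae_restrict_of_ae (coeFn_weylShift (F x) φ))

theorem ae_integrable_mul_weylIntegrand {m : Measure X} [SFinite m] {F : X → PhaseSpace n}
    (hF : Measurable F) {c : X → ℂ} (hc : Integrable c m) (φ : L2Space n) :
    ∀ᵐ t, Integrable (fun x => c x * weylIntegrand φ t (F x)) m := by
  refine ae_of_forall_measure_lt_top_ae_restrict _ fun A hAm hA => ?_
  exact (integrable_mul_weylIntegrand_prod hF hc φ hA).prod_left_ae

/-- The Bochner integral defining a superposition can be computed pointwise. -/
theorem coeFn_weylSuperposition {m : Measure X} [SFinite m] {F : X → PhaseSpace n}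
    (hF : Measurable F) {c : X → ℂ} (hc : Integrable c m) (φ : L2Space n) :
    weylSuperposition m hF hc φ =ᵐ[volume] fun t => ∫ x, c x * weylIntegrand φ t (F x) ∂m := by
  refine ae_eq_of_forall_setIntegral_eq_of_sigmaFinite (fun A hAm hA => ?_) (fun A hAm hA => ?_)
    fun A hAm hA => setIntegral_weylSuperposition hF hc φ hAm hA
  · have : IsFiniteMeasure (volume.restrict A) := ⟨by simpa using hA⟩
    exact ((Lp.memLp (weylSuperposition m hF hc φ)).restrict A).integrable (by norm_num)
  · exact (integrable_mul_weylIntegrand_prod hF hc φ hA).integral_prod_right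

end Pointwise

/-! ### Compactness for absolutely continuous symbols -/

section SmoothSymbol

open Set Filter Topology FourierTransform

variable {n : ℕ}

/-- The partial Fourier transform `∫ g(x, y) exp(πi (x ⬝ y + 2 y ⬝ t)) dy`; the superposition of the
shifts with density `g` has the integral kernel `(t, s) ↦ weylKernel g t (s - t)`. -/
noncomputable def weylKernel (g : PhaseSpace n → ℂ) (t x : EuclideanSpace ℝ (Fin n)) : ℂ :=
  ∫ y, g (WithLp.toLp 2 (x, y)) * weylPhase (WithLp.toLp 2 (x, y)) t

theorem continuous_toLp_mk (x : EuclideanSpace ℝ (Fin n)) :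
    Continuous fun y : EuclideanSpace ℝ (Fin n) => (WithLp.toLp 2 (x, y) : PhaseSpace n) :=
  (WithLp.prod_continuous_toLp 2 _ _).comp (Continuous.prodMk_right x)

/-- The restriction of a test function on phase space to a fibre, as a Schwartz function. -/
theorem exists_schwartz_slice {g : PhaseSpace n → ℂ} (hg : ContDiff ℝ ∞ g)
    (hgc : HasCompactSupport g) (x : EuclideanSpace ℝ (Fin n)) :
    ∃ f : SchwartzMap (EuclideanSpace ℝ (Fin n)) ℂ, ∀ y, f y = g (WithLp.toLp 2 (x, y)) := by
  have h1 : ContDiff ℝ ∞ fun y => g (WithLp.toLp 2 (x, y)) := by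
    refine hg.comp ?_
    have : ContDiff ℝ ∞ (WithLp.prodContinuousLinearEquiv 2 ℝ (EuclideanSpace ℝ (Fin n))
      (EuclideanSpace ℝ (Fin n))).symm := ContinuousLinearEquiv.contDiff _
    exact this.comp (contDiff_const.prodMk contDiff_id)
  have h2 : HasCompactSupport fun y => g (WithLp.toLp 2 (x, y)) := by
    have hi : Topology.IsClosedEmbedding
        fun y : EuclideanSpace ℝ (Fin n) => (WithLp.toLp 2 (x, y) : PhaseSpace n) := by
      exact Function.LeftInverse.isClosedEmbedding (f := fun p : PhaseSpace n => p.snd)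
        (fun y => rfl) continuous_snd_phaseSpace (continuous_toLp_mk x)
    exact hgc.comp_isClosedEmbedding hi
  exact ⟨h2.toSchwartzMap h1, fun y => rfl⟩

theorem weylKernel_eq_fourier {g : PhaseSpace n → ℂ} {x : EuclideanSpace ℝ (Fin n)}
    {f : SchwartzMap (EuclideanSpace ℝ (Fin n)) ℂ} (hf : ∀ y, f y = g (WithLp.toLp 2 (x, y)))
    (t : EuclideanSpace ℝ (Fin n)) :
    weylKernel g t x = (𝓕 f) (-(2⁻¹ : ℝ) • x - t) := by
  rw [SchwartzMap.fourier_coe, Real.fourier_eq, weylKernel]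
  refine integral_congr_ae (Eventually.of_forall fun y => ?_)
  simp only [hf, weylPhase, Circle.smul_def, Real.fourierChar_apply, smul_eq_mul]
  rw [mul_comm]
  congr 2
  rw [inner_sub_right, inner_smul_right, real_inner_comm x y]
  simp only [WithLp.toLp_fst, WithLp.toLp_snd]
  push_cast
  ring

/-- Plancherel's theorem in the fibre variable. -/
theorem integral_norm_sq_weylKernel {g : PhaseSpace n → ℂ} (hg : ContDiff ℝ ∞ g)
    (hgc : HasCompactSupport g) (x : EuclideanSpace ℝ (Fin n)) :
    Integrable (fun t => ‖weylKernel g t x‖ ^ 2) ∧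
    ∫ t, ‖weylKernel g t x‖ ^ 2 = ∫ y, ‖g (WithLp.toLp 2 (x, y))‖ ^ 2 := by
  obtain ⟨f, hf⟩ := exists_schwartz_slice hg hgc x
  simp only [weylKernel_eq_fourier hf, ← hf]
  constructor
  · have h : Integrable fun t => ‖(𝓕 f) t‖ ^ 2 :=
      (memLp_two_iff_integrable_sq_norm (𝓕 f).continuous.aestronglyMeasurable).mp
        ((𝓕 f).memLp 2 volume)
    exact h.comp_sub_left _
  · exact (integral_sub_left_eq_self (fun t => ‖(𝓕 f) t‖ ^ 2) volume _).trans
      (SchwartzMap.integral_norm_sq_fourier f)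

theorem stronglyMeasurable_weylKernel {g : PhaseSpace n → ℂ} (hg : Continuous g) :
    StronglyMeasurable fun z : EuclideanSpace ℝ (Fin n) × EuclideanSpace ℝ (Fin n) =>
      weylKernel g z.1 z.2 := by
  have hc : Continuous fun w : (EuclideanSpace ℝ (Fin n) × EuclideanSpace ℝ (Fin n)) ×
      EuclideanSpace ℝ (Fin n) => g (WithLp.toLp 2 (w.1.2, w.2)) *
        weylPhase (WithLp.toLp 2 (w.1.2, w.2)) w.1.1 := by
    have h1 : Continuous fun w : (EuclideanSpace ℝ (Fin n) × EuclideanSpace ℝ (Fin n)) ×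
        EuclideanSpace ℝ (Fin n) => (WithLp.toLp 2 (w.1.2, w.2) : PhaseSpace n) :=
      (WithLp.prod_continuous_toLp 2 _ _).comp
        ((continuous_snd.comp continuous_fst).prodMk continuous_snd)
    have h2 := continuous_weylPhase.comp (h1.prodMk (continuous_fst.comp continuous_fst))
    have h3 := hg.comp h1
    simp only [Function.comp_def] at h2 h3
    exact h3.mul h2
  exact hc.stronglyMeasurable.integral_prod_right'

theorem integrable_integral_norm_sq_slice {g : PhaseSpace n → ℂ} (hg : Continuous g)
    (hgc : HasCompactSupport g) :
    Integrable fun x : EuclideanSpace ℝ (Fin n) =>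
      ∫ y : EuclideanSpace ℝ (Fin n), ‖g (WithLp.toLp 2 (x, y))‖ ^ 2 := by
  have h1 : Integrable fun p : PhaseSpace n => ‖g p‖ ^ 2 :=
    (hg.norm.pow 2).integrable_of_hasCompactSupport
      (HasCompactSupport.intro hgc fun p hp => by simp [image_eq_zero_of_notMem_tsupport hp])
  have h2 := (WithLp.volume_preserving_toLp (EuclideanSpace ℝ (Fin n))
    (EuclideanSpace ℝ (Fin n))).integrable_comp_of_integrable h1
  rw [Measure.volume_eq_prod] at h2
  have h3 := h2.integral_prod_left
  simpa only [Function.comp_def] using h3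

theorem integrable_norm_sq_weylKernel {g : PhaseSpace n → ℂ} (hg : ContDiff ℝ ∞ g)
    (hgc : HasCompactSupport g) :
    Integrable (fun z : EuclideanSpace ℝ (Fin n) × EuclideanSpace ℝ (Fin n) =>
      ‖weylKernel g z.1 z.2‖ ^ 2) (volume.prod volume) := by
  have hm : AEStronglyMeasurable (fun z : EuclideanSpace ℝ (Fin n) × EuclideanSpace ℝ (Fin n) =>
      ‖weylKernel g z.1 z.2‖ ^ 2) (volume.prod volume) :=
    ((stronglyMeasurable_weylKernel hg.continuous).norm.pow 2).aestronglyMeasurable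
  rw [integrable_prod_iff' hm]
  refine ⟨Eventually.of_forall fun x => (integral_norm_sq_weylKernel hg hgc x).1,
    (integrable_integral_norm_sq_slice hg.continuous hgc).congr
      (Eventually.of_forall fun x => ?_)⟩
  refine (integral_norm_sq_weylKernel hg hgc x).2.symm.trans
    (integral_congr_ae (Eventually.of_forall fun t => ?_))
  exact (Real.norm_of_nonneg (sq_nonneg ‖weylKernel g t x‖)).symm

/-- The superposition of shifts with a test function as density is an integral operator. -/
theorem ae_weylSuperposition_eq_integral_weylKernel {g : PhaseSpace n → ℂ} (hg : Integrable g)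
    (φ : L2Space n) :
    ∀ᵐ t, weylSuperposition volume measurable_id hg φ t = ∫ x, weylKernel g t x * φ (t + x) := by
  filter_upwards [coeFn_weylSuperposition measurable_id hg φ,
    ae_integrable_mul_weylIntegrand measurable_id hg φ] with t h1 h2
  have hmp := WithLp.volume_preserving_toLp (EuclideanSpace ℝ (Fin n)) (EuclideanSpace ℝ (Fin n))
  have hme : MeasurableEmbedding (WithLp.toLp 2 :
      EuclideanSpace ℝ (Fin n) × EuclideanSpace ℝ (Fin n) → PhaseSpace n) :=
    (MeasurableEquiv.toLp 2 _).measurableEmbedding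
  have h3 := hmp.integrable_comp_of_integrable h2
  rw [h1, ← hmp.integral_comp hme]
  rw [Measure.volume_eq_prod] at h3 ⊢
  simp only [Function.comp_def] at h3
  rw [integral_prod _ h3]
  refine integral_congr_ae (Eventually.of_forall fun x => ?_)
  simp only [weylKernel]
  rw [← integral_mul_const]
  refine integral_congr_ae (Eventually.of_forall fun y => ?_)
  simp only [id, weylIntegrand_eq, WithLp.toLp_fst, mul_assoc]

/-- Bessel's inequality for the rows of the kernel. -/
theorem sum_norm_sq_integral_weylKernel_le {g : PhaseSpace n → ℂ} (hg : Continuous g)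
    {t : EuclideanSpace ℝ (Fin n)} (ht : Integrable fun x => ‖weylKernel g t x‖ ^ 2) {N : ℕ}
    {e : Fin N → L2Space n} (he : Orthonormal ℂ e) :
    ∑ i, ‖∫ x, weylKernel g t x * e i (t + x)‖ ^ 2 ≤ ∫ x, ‖weylKernel g t x‖ ^ 2 := by
  have hkm : StronglyMeasurable (weylKernel g t) :=
    (stronglyMeasurable_weylKernel hg).comp_measurable measurable_prodMk_left
  have hK : MemLp (fun s => (starRingEnd ℂ) (weylKernel g t (s - t))) 2 volume := by
    refine (memLp_two_iff_integrable_sq_norm ?_).mpr ?_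
    · exact (Complex.continuous_conj.comp_stronglyMeasurable
        (hkm.comp_measurable (measurable_id.sub_const t))).aestronglyMeasurable
    · simpa using ht.comp_sub_right t
  have hnorm : ‖hK.toLp _‖ ^ 2 = ∫ x, ‖weylKernel g t x‖ ^ 2 := by
    rw [L2Space.norm_sq_eq_integral,
      ← integral_sub_right_eq_self (fun x => ‖weylKernel g t x‖ ^ 2) t]
    refine integral_congr_ae (hK.coeFn_toLp.mono fun s hs => ?_)
    simp only [hs, RCLike.norm_conj]
  have hinner : ∀ i, ⟪hK.toLp _, e i⟫_ℂ = ∫ x, weylKernel g t x * e i (t + x) := by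
    intro i
    rw [L2.inner_def, ← integral_add_left_eq_self _ t]
    have := (measurePreserving_add_left volume t).quasiMeasurePreserving.ae_eq_comp hK.coeFn_toLp
    refine integral_congr_ae (this.mono fun x hx => ?_)
    simp only [Function.comp_apply, add_sub_cancel_left] at hx
    simp only [RCLike.inner_apply, hx, Complex.conj_conj]
    ring
  rw [← hnorm]
  refine le_trans (le_of_eq ?_) (he.sum_inner_products_le (hK.toLp _) (s := Finset.univ))
  refine Finset.sum_congr rfl fun i _ => ?_
  rw [norm_inner_symm, hinner]

/-- The superposition of shifts with a test function as density is a Hilbert–Schmidt operator. -/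
theorem isCompactOperator_weylSuperposition_of_contDiff {g : PhaseSpace n → ℂ}
    (hg : ContDiff ℝ ∞ g) (hgc : HasCompactSupport g) (hgi : Integrable g) :
    IsCompactOperator (weylSuperposition volume measurable_id hgi) := by
  have hk := integrable_norm_sq_weylKernel hg hgc
  refine isCompactOperator_of_sum_norm_sq_le _ (C := ∫ t, ∫ x, ‖weylKernel g t x‖ ^ 2)
    fun N e he => ?_
  have hint : ∀ f : L2Space n, Integrable fun t => ‖f t‖ ^ 2 := fun f =>
    (memLp_two_iff_integrable_sq_norm (Lp.aestronglyMeasurable f)).mp (Lp.memLp f)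
  simp only [L2Space.norm_sq_eq_integral]
  rw [← integral_finsetSum _ fun i _ => hint _]
  refine integral_mono_ae (integrable_finsetSum _ fun i _ => hint _) hk.integral_prod_left ?_
  have hall := ae_all_iff.mpr fun i =>
    ae_weylSuperposition_eq_integral_weylKernel hgi (e i)
  filter_upwards [hall, hk.prod_right_ae] with t h1 h2
  simp only [h1]
  exact sum_norm_sq_integral_weylKernel_le hg.continuous h2 he

end SmoothSymbol

section AbsolutelyContinuousSymbol

open Set Filter Topology

variable {n : ℕ}

theorem isCompactOperator_weylSuperposition_volume {f : PhaseSpace n → ℂ} (hf : Integrable f) :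
    IsCompactOperator (weylSuperposition volume measurable_id hf) := by
  have hcl : IsClosed {S : L2Space n →L[ℂ] L2Space n | IsCompactOperator S} :=
    isClosed_setOfPred_isCompactOperator
  refine hcl.closure_subset_iff.mpr subset_rfl (Metric.mem_closure_iff.mpr fun ε hε => ?_)
  obtain ⟨g, hgc, hg, hfg⟩ := (memLp_one_iff_integrable.mpr hf).exist_eLpNorm_sub_le
    ENNReal.one_ne_top le_rfl (half_pos hε)
  have hgi : Integrable g := hg.continuous.integrable_of_hasCompactSupport hgc
  refine ⟨_, isCompactOperator_weylSuperposition_of_contDiff hg hgc hgi, ?_⟩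
  rw [dist_eq_norm]
  refine ((norm_weylSuperposition_sub_le volume measurable_id hf hgi).trans ?_).trans_lt
    (half_lt_self hε)
  rw [eLpNorm_one_eq_lintegral_enorm] at hfg
  have h1 := integral_norm_eq_lintegral_enorm (hf.sub hgi).aestronglyMeasurable
  simp only [Pi.sub_apply] at h1 hfg
  rw [h1]
  exact ENNReal.toReal_le_of_le_ofReal (half_pos hε).le hfg

/-- Superpositions of shifts with a symbol that is absolutely continuous with respect to Lebesgue
measure are compact: by approximation of the coefficient by simple functions, it suffices to treat
indicators, where the symbol is a multiple of a positive measure with a density in `L¹`. -/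
theorem HasWeylSymbol.isCompactOperator {T : L2Space n →L[ℂ] L2Space n}
    (h : HasWeylSymbol volume T) : IsCompactOperator T := by
  obtain ⟨X, i, m, i', F, hF, c, hc, hm, rfl⟩ := h
  have key : ∀ ⦃c : X → ℂ⦄, Integrable c m → ∀ hc : Integrable c m,
      IsCompactOperator (weylSuperposition m hF hc) := by
    refine Integrable.induction (fun c => ∀ hc : Integrable c m,
      IsCompactOperator (weylSuperposition m hF hc)) ?_ ?_ ?_ ?_
    · intro a s hs _ hc
      -- With `ρ` the image of `m` on `s`, the superposition has the symbol `a ρ`.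
      have hρ : (m.restrict s).map F ≪ volume := by
        refine Measure.AbsolutelyContinuous.trans ?_ hm
        exact (Measure.absolutelyContinuous_of_le Measure.restrict_le_self).map hF
      set ρ := (m.restrict s).map F with hρdef
      have hfin : IsFiniteMeasure ρ := by rw [hρdef]; infer_instance
      have hd : Integrable (fun p => a * ((ρ.rnDeriv volume p).toReal : ℂ)) :=
        (Measure.integrable_toReal_rnDeriv (μ := ρ) (ν := volume)).ofReal.const_mul a
      convert isCompactOperator_weylSuperposition_volume hd using 2
      ext1 φ
      rw [weylSuperposition_apply, weylSuperposition_apply]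
      have h1 : ∫ x, s.indicator (fun _ => a) x • weylShift (F x) φ ∂m =
          ∫ x in s, a • weylShift (F x) φ ∂m := by
        rw [← integral_indicator hs]
        refine integral_congr_ae (Eventually.of_forall fun x => ?_)
        by_cases hx : x ∈ s <;> simp [hx]
      have h2 : ∫ x in s, a • weylShift (F x) φ ∂m = ∫ p, a • weylShift p φ ∂ρ := by
        have hsm : Continuous fun p : PhaseSpace n => a • weylShift p φ :=
          (continuous_weylShift φ).const_smul a
        rw [hρdef, integral_map hF.aemeasurable hsm.aestronglyMeasurable]
      rw [h1, h2, ← integral_rnDeriv_smul hρ]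
      refine integral_congr_ae (Eventually.of_forall fun p => ?_)
      simp only [id, mul_smul, Complex.coe_smul]
      exact smul_comm _ _ _
    · intro f g _ hf hg h1 h2 hc
      rw [weylSuperposition_congr m hF hc (hf.add hg) EventuallyEq.rfl,
        weylSuperposition_add m hF hf hg]
      exact (h1 hf).add (h2 hg)
    · have hcl : IsClosed {S : L2Space n →L[ℂ] L2Space n | IsCompactOperator S} :=
        isClosed_setOfPred_isCompactOperator
      have hcont : Continuous fun f : X →₁[m] ℂ =>
          weylSuperposition m hF (L1.integrable_coeFn f) := by
        refine LipschitzWith.continuous (K := 1) (LipschitzWith.of_dist_le_mul fun f g => ?_)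
        rw [NNReal.coe_one, one_mul, dist_eq_norm, L1.dist_eq_integral_dist]
        simp only [dist_eq_norm]
        exact norm_weylSuperposition_sub_le m hF _ _
      convert hcl.preimage hcont using 1
      ext f
      exact ⟨fun h => h _, fun h _ => h⟩
    · intro f g hfg hf h1 hc
      rw [← weylSuperposition_congr m hF hf hc hfg]
      exact h1 hf
  exact key hc hc

end AbsolutelyContinuousSymbol

/-! ### Integration against a complex measure with a density -/

section ComplexDensity

open Filter Topology
open scoped ENNReal

variable {X : Type*} [MeasurableSpace X] {m : Measure X} {ψ : X → ℂ}

theorem lintegral_enorm_mul_eq_lintegral_variation (hψ : Integrable ψ m) {f : X → ℂ}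
    (hf : StronglyMeasurable f) :
    ∫⁻ x, ‖ψ x * f x‖ₑ ∂m = ∫⁻ x, ‖f x‖ₑ ∂(m.withDensityᵥ ψ).variation := by
  rw [Measure.variation_withDensityᵥ hψ,
    lintegral_withDensity_eq_lintegral_mul₀ hψ.aestronglyMeasurable.enorm
      hf.measurable.enorm.aemeasurable]
  simp only [enorm_mul, Pi.mul_apply]

theorem integrable_variation_withDensityᵥ_iff (hψ : Integrable ψ m) {f : X → ℂ}
    (hf : StronglyMeasurable f) :
    (m.withDensityᵥ ψ).Integrable f ↔ Integrable (fun x => ψ x * f x) m := by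
  have h := lintegral_enorm_mul_eq_lintegral_variation hψ hf
  have hm : AEStronglyMeasurable (fun x => ψ x * f x) m :=
    hψ.aestronglyMeasurable.mul hf.aestronglyMeasurable
  simp only [VectorMeasure.Integrable, Integrable, HasFiniteIntegral, h,
    hf.aestronglyMeasurable, hm, true_and]

theorem ae_mul_eq_of_ae_variation (hψ : Integrable ψ m) {f g : X → ℂ}
    (h : f =ᵐ[(m.withDensityᵥ ψ).variation] g) :
    (fun x => ψ x * f x) =ᵐ[m] fun x => ψ x * g x := by
  rw [Measure.variation_withDensityᵥ hψ] at h
  have h' := (ae_withDensity_iff' hψ.aestronglyMeasurable.enorm).mp h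
  filter_upwards [h'] with x hx
  by_cases h0 : ψ x = 0
  · simp [h0]
  · rw [hx (by simpa using h0)]

theorem integrable_mul_of_integrable_variation (hψ : Integrable ψ m) {f : X → ℂ}
    (hf : (m.withDensityᵥ ψ).Integrable f) : Integrable (fun x => ψ x * f x) m := by
  have hsm := hf.aestronglyMeasurable.stronglyMeasurable_mk
  exact ((integrable_variation_withDensityᵥ_iff hψ hsm).mp
    (hf.congr hf.aestronglyMeasurable.ae_eq_mk)).congr
      (ae_mul_eq_of_ae_variation hψ hf.aestronglyMeasurable.ae_eq_mk).symm

/-- Integrating against the complex measure `ψ m` amounts to integrating the product with `ψ`. -/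
theorem integral_withDensityᵥ_mul (hψ : Integrable ψ m) {f : X → ℂ}
    (hf : (m.withDensityᵥ ψ).Integrable f) :
    (m.withDensityᵥ ψ).integral f (ContinuousLinearMap.mul ℝ ℂ) = ∫ x, ψ x * f x ∂m := by
  refine Integrable.induction (fun f => (m.withDensityᵥ ψ).integral f
    (ContinuousLinearMap.mul ℝ ℂ) = ∫ x, ψ x * f x ∂m) ?_ ?_ ?_ ?_ hf
  · intro c s hs hms
    rw [VectorMeasure.integral_eq_setToFun, setToFun_indicator_const _ hs hms.ne]
    change c * (m.withDensityᵥ ψ) s = _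
    rw [withDensityᵥ_apply hψ hs, ← integral_indicator hs, ← integral_const_mul]
    refine integral_congr_ae (Eventually.of_forall fun x => ?_)
    by_cases hx : x ∈ s <;> simp [hx, mul_comm]
  · intro f g _ hf hg hf' hg'
    rw [VectorMeasure.integral_add hf hg, hf', hg', ← integral_add
      (integrable_mul_of_integrable_variation hψ hf) (integrable_mul_of_integrable_variation hψ hg)]
    simp only [Pi.add_apply, mul_add]
  · refine isClosed_eq VectorMeasure.continuous_integral ?_
    refine LipschitzWith.continuous (K := 1) fun f g => ?_
    have hf := integrable_mul_of_integrable_variation hψ (L1.integrable_coeFn f)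
    have hg := integrable_mul_of_integrable_variation hψ (L1.integrable_coeFn g)
    rw [edist_eq_enorm_sub, ← integral_sub hf hg, ENNReal.coe_one, one_mul, Lp.edist_def,
      eLpNorm_one_eq_lintegral_enorm]
    refine (enorm_integral_le_lintegral_enorm _).trans (le_of_eq ?_)
    have h := lintegral_enorm_mul_eq_lintegral_variation hψ
      ((Lp.stronglyMeasurable f).sub (Lp.stronglyMeasurable g))
    simpa only [Pi.sub_apply, mul_sub] using h
  · intro f g hfg _ hf
    rw [← VectorMeasure.integral_congr_ae hfg, hf]
    exact integral_congr_ae (ae_mul_eq_of_ae_variation hψ hfg)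

end ComplexDensity

/-! ### The Weyl transform of a smooth measure -/

section WeylTransform

variable {n : ℕ}

theorem isWeylTransform_weylSuperposition {m : Measure (PhaseSpace n)} [SFinite m]
    {ψ : PhaseSpace n → ℂ} (hψ : Integrable ψ m) :
    IsWeylTransform (m.withDensityᵥ ψ) (weylSuperposition m measurable_id hψ) := by
  intro φ
  filter_upwards [coeFn_weylSuperposition measurable_id hψ φ,
    ae_integrable_mul_weylIntegrand measurable_id hψ φ] with t h1 h2
  have hsm : StronglyMeasurable (weylIntegrand φ t) := by
    have h := (stronglyMeasurable_weylIntegrand (F := id) measurable_id φ).comp_measurable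
      (measurable_prodMk_right (y := t))
    simpa only [Function.comp_def, id] using h
  have hint := (integrable_variation_withDensityᵥ_iff hψ hsm).mpr h2
  exact ⟨hint, h1.trans (integral_withDensityᵥ_mul hψ hint).symm⟩

/-- If `S` is a superposition of shifts along a transversal measure `m`, then `(S†S)ᵏ` is one along
a `2k`-fold convolution of copies of `m` and of its reflection, and the rank is at least `2k`. -/
theorem HasWeylSymbol.exists_pow_adjoint_comp_self {m : Measure (PhaseSpace n)} [SFinite m]
    (hm : IsTransversal m) {S : L2Space n →L[ℂ] L2Space n} (hS : HasWeylSymbol m S) (k : ℕ) :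
    ∃ ρ : Measure (PhaseSpace n), SFinite ρ ∧ HasRankGE (2 * k) ρ ∧
      HasWeylSymbol ρ ((ContinuousLinearMap.adjoint S ∘L S) ^ k) := by
  induction k with
  | zero => exact ⟨Measure.dirac 0, inferInstance, HasRankGE.dirac_zero, HasWeylSymbol.one⟩
  | succ k ih =>
    obtain ⟨ρ, _, hρ, h⟩ := ih
    have : SFinite (m.map fun p => -p) := inferInstance
    -- The power is bracketed as `((S†S)ᵏ ∘ S†) ∘ S`, so that each factor costs one convolution.
    exact ⟨(ρ.conv (m.map fun p => -p)).conv m, inferInstance, (hρ.conv hm.map_neg).conv hm,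
      (h.comp hS.adjoint).comp hS⟩

/-- A superposition of shifts along a transversal measure is compact: a high power of `S†S` has an
absolutely continuous symbol. -/
theorem HasWeylSymbol.isCompactOperator_of_isTransversal {m : Measure (PhaseSpace n)} [SFinite m]
    (hm : IsTransversal m) {S : L2Space n →L[ℂ] L2Space n} (hS : HasWeylSymbol m S) :
    IsCompactOperator S := by
  set A := ContinuousLinearMap.adjoint S ∘L S with hA
  refine isCompactOperator_of_adjoint_comp_self S ?_
  refine isCompactOperator_of_isSelfAdjoint_of_pow A ?_ (Module.finrank ℝ (PhaseSpace n)) ?_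
  · exact IsSelfAdjoint.star_mul_self S
  · obtain ⟨ρ, _, hρ, h⟩ :=
      hS.exists_pow_adjoint_comp_self hm (2 ^ Module.finrank ℝ (PhaseSpace n))
    exact (h.mono (hρ.absolutelyContinuous
      (Nat.lt_two_pow_self.le.trans (Nat.le_mul_of_pos_left _ two_pos)) volume)).isCompactOperator

end WeylTransform

section SmoothMeasure

variable {n d : ℕ} {M : Set (PhaseSpace n)} {ψ : PhaseSpace n → ℂ}

/-- Only the part of `M` in the support of the density contributes to a smooth measure. -/
theorem withDensityᵥ_surfaceMeasure_eq_restrict_tsupport (hψ : Integrable ψ (surfaceMeasure d M)) :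
    (surfaceMeasure d M).withDensityᵥ ψ =
      ((surfaceMeasure d M).restrict (tsupport ψ)).withDensityᵥ ψ := by
  ext s hs
  rw [withDensityᵥ_apply hψ hs, withDensityᵥ_apply hψ.restrict hs,
    Measure.restrict_restrict hs]
  exact (setIntegral_eq_of_subset_of_forall_sdiff_eq_zero hs Set.inter_subset_left
    fun x hx => image_eq_zero_of_notMem_tsupport fun h => hx.2 ⟨hx.1, h⟩)

theorem isFiniteMeasure_surfaceMeasure_restrict_tsupport (hM : IsAnalyticSubmanifold d M)
    (hc : IsCompact (tsupport ψ ∩ M)) :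
    IsFiniteMeasure ((surfaceMeasure d M).restrict (tsupport ψ)) := by
  rw [surfaceMeasure, Measure.restrict_restrict (isClosed_tsupport ψ).measurableSet]
  exact ⟨by simpa using hM.euclideanHausdorffMeasure_lt_top hc Set.inter_subset_right⟩

theorem integrable_surfaceMeasure (hM : IsAnalyticSubmanifold d M) (hψ : Continuous ψ)
    (hc : IsCompact (tsupport ψ ∩ M)) : Integrable ψ (surfaceMeasure d M) := by
  have h1 : IntegrableOn ψ (tsupport ψ) (surfaceMeasure d M) := by
    rw [IntegrableOn, surfaceMeasure,
      Measure.restrict_restrict (isClosed_tsupport ψ).measurableSet]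
    exact hψ.continuousOn.integrableOn_of_subset_isCompact hc hc.measurableSet subset_rfl
      (hM.euclideanHausdorffMeasure_lt_top hc Set.inter_subset_right).ne
  exact (integrableOn_iff_integrable_of_support_subset (subset_tsupport ψ)).mp h1

end SmoothMeasure

theorem theorem1p2 (n d : ℕ) (M : Set (PhaseSpace n))
    (hM : IsAnalyticSubmanifold d M) (hconn : IsConnected M)
    (hplane : ∀ H : Set (PhaseSpace n), IsAffineHyperplane H → ¬ M ⊆ H)
    (μ : ComplexMeasure (PhaseSpace n)) (hμ : IsSmoothMeasureOn d M μ) :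
    ∃ W : L2Space n →L[ℂ] L2Space n, IsWeylTransform μ W ∧ IsCompactOperator W := by
  obtain ⟨ψ, hψ, hc, rfl⟩ := hμ
  have hint := integrable_surfaceMeasure hM hψ.continuous hc
  have := isFiniteMeasure_surfaceMeasure_restrict_tsupport hM hc
  rw [withDensityᵥ_surfaceMeasure_eq_restrict_tsupport hint]
  refine ⟨weylSuperposition _ measurable_id hint.restrict,
    isWeylTransform_weylSuperposition hint.restrict, ?_⟩
  refine HasWeylSymbol.isCompactOperator_of_isTransversal
    (m := (surfaceMeasure d M).restrict (tsupport ψ))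
    ((isTransversal_surfaceMeasure hM hconn.isPreconnected hplane).mono
      (Measure.absolutelyContinuous_of_le Measure.restrict_le_self)) ?_
  exact ⟨_, _, _, this, id, measurable_id, ψ, hint.restrict, by rw [Measure.map_id], rfl⟩
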